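/- **Setting.** Let $G=(V,E)$ be an infinite connected simple graph with bounded vertex degrees and shortest path distance $d_G$. For finite $Q\subset V$ put $\partial Q=\{p\in Q : \exists q\notin Q,\ (p,q)\in E\}$. A *Følner sequence* is a sequence $(Q_n)_{n\ge1}$ of finite nonempty subsets of $V$ with $|\partial Q_n|/|Q_n|\to 0$; assume that $G$ has one. Let $B_r(x)=\{y: d_G(x,y)\le r\}$, regarded as an induced subgraph. Two vertices $x,y$ have the same $r$-pattern if there is a graph isomorphism $B_r(x)\to B_r(y)$ mapping $x$ to $y$. Assume that $G$ is an *abstract quasicrystal graph*: for every $r$ and every $r$-pattern $\alpha$ there is a number $P(\alpha)$ such that, for every Følner sequence $(Q_n)$, $|Q_n^\alpha|/|Q_n|\to P(\alpha)$, where $Q_n^\alpha$ is the set of vertices of $Q_n$ with $r$-pattern $\alpha$. A *pattern-invariant matrix* is a function $A:V\times V\to\mathbb C$ for which there is $r\in\mathbb N$ such that $A(x,y)=0$ whenever $d_G(x,y)>r$, and $A(x,y)=A(\phi(x),\phi(y))$ for all $y\in B_r(x)$ and every graph isomorphism $\phi:B_r(x)\to B_r(\phi(x))$ of balls that maps the centre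 $x$ to the centre $\phi(x)$. With matrix multiplication and $A^*(x,y)=\overline{A(y,x)}$ these matrices form a unital $*$-algebra $P_G$, which acts by bounded operators on $L^2(V)$ via $(Af)(x)=\sum_{y}A(x,y)f(y)$. For $A\in P_G$ the limit $\mathrm{Tr}_G(A)=\lim_n |Q_n|^{-1}\sum_{x\in Q_n}A(x,x)$ exists and does not depend on the Følner sequence. Let $H_G$ be the Hilbert space obtained from $P_G$ with the positive semidefinite form $\langle A,B\rangle=\mathrm{Tr}_G(B^*A)$ by separation and completion, let $\psi_G:P_G\to B(H_G)$ be the representation by left multiplication (these operators are bounded), and let $N_G$ be the closure of $\psi_G(P_G)$ in the weak operator topology. Put $\mathrm{Tr}_G(T)=\langle T\mathbf 1,\mathbf 1\rangle$ for $T\in N_G$, where $\mathbf 1\in H_G$ is the class of the identity matrix. **Proposition 6.1.** Let $B\in P_G$ be positive and self-adjoint as an operator on $L^2(V)$, and suppose that $B(x,y)\in\mathbb Q$ for all $x,y\in V$. Let $E_0^B\in N_G$ be the orthogonal projection onto the kernel of $\psi_G(B)$, i.e. the spectral projection $\chi_{[0,0]}(\psi_G(B))$. Then for every Følner sequence $(Q_n)$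 in $G$, $$\lim_{n\to\infty}\frac{\dim_{\mathbb C}\mathrm{Ker}\,B_n}{|Q_n|}=\mathrm{Tr}_G(E_0^B),$$ where $B_n=(B(x,y))_{x,y\in Q_n}$ is the truncation of $B$ to $Q_n$. -/

import Mathlib

open Filter Topology

namespace QuasiCrystal

universe u

variable {V : Type u}

/-- The ball `B_r(x)` for the shortest path distance. -/
def rBall (G : SimpleGraph V) (x : V) (r : ℕ) : Set V := {y | G.dist x y ≤ r}

/-- The ball `B_r(x)` as an (induced) subgraph of `G`. -/
abbrev ballGraph (G : SimpleGraph V) (x : V) (r : ℕ) : SimpleGraph (rBall G x r) :=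
  G.induce (rBall G x r)

/-- The root of the ball `B_r(x)`. -/
def ballRoot (G : SimpleGraph V) (x : V) (r : ℕ) : rBall G x r := ⟨x, by simp [rBall]⟩

/-- `x` and `y` have the same `r`-pattern: there is a graph isomorphism `B_r(x) ≃ B_r(y)`
mapping `x` to `y`. -/
def SamePattern (G : SimpleGraph V) (r : ℕ) (x y : V) : Prop :=
  ∃ φ : ballGraph G x r ≃g ballGraph G y r, φ (ballRoot G x r) = ballRoot G y r

theorem samePattern_equivalence (G : SimpleGraph V) (r : ℕ) :
    Equivalence (SamePattern G r) where
  refl _ := ⟨SimpleGraph.Iso.refl, rfl⟩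
  symm := by
    rintro x y ⟨φ, h⟩
    exact ⟨φ.symm, by rw [← h]; exact φ.symm_apply_apply _⟩
  trans := by
    rintro x y z ⟨φ, h⟩ ⟨χ, h'⟩
    exact ⟨φ.trans χ, by rw [← h', ← h]; rfl⟩

/-- The equivalence relation "same `r`-pattern". -/
def patternSetoid (G : SimpleGraph V) (r : ℕ) : Setoid V :=
  ⟨SamePattern G r, samePattern_equivalence G r⟩

/-- The set `P_r(G)` of all `r`-patterns that occur in `G`. -/
abbrev Pattern (G : SimpleGraph V) (r : ℕ) : Type u := Quotient (patternSetoid G r)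

/-- The `r`-pattern of a vertex. -/
def patternOf (G : SimpleGraph V) (r : ℕ) (x : V) : Pattern G r :=
  Quotient.mk (patternSetoid G r) x

open scoped Classical in
/-- The set `Q^α` of the vertices of `Q` with `r`-pattern `α`. -/
noncomputable def withPattern (G : SimpleGraph V) {r : ℕ} (α : Pattern G r) (Q : Finset V) :
    Finset V :=
  Q.filter fun x => patternOf G r x = α

open scoped Classical in
/-- The boundary `∂Q`: the vertices of `Q` that have a neighbour outside of `Q`. -/
noncomputable def boundary (G : SimpleGraph V) (Q : Finset V) : Finset V :=
  Q.filter fun p => ∃ q, q ∉ Q ∧ G.Adj p q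

/-- Følner sequences: finite nonempty vertex sets with `|∂Q_n| / |Q_n| → 0`. -/
structure IsFolner (G : SimpleGraph V) (Q : ℕ → Finset V) : Prop where
  nonempty : ∀ n, (Q n).Nonempty
  tendsto : Tendsto (fun n => ((boundary G (Q n)).card : ℝ) / ((Q n).card : ℝ)) atTop (𝓝 0)

/-- Abstract quasi-crystal graphs: infinite connected amenable graphs with bounded vertex
degrees, in which every pattern has a frequency along all Følner sequences. -/
class AQGraph (G : SimpleGraph V) : Prop where
  infinite : Infinite V
  connected : G.Connected
  bounded_degree : ∃ d : ℕ, ∀ x, (G.neighborSet x).encard ≤ d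
  amenable : ∃ Q : ℕ → Finset V, IsFolner G Q
  frequency : ∀ (r : ℕ) (α : Pattern G r), ∃ p : ℝ, ∀ Q : ℕ → Finset V, IsFolner G Q →
    Tendsto (fun n => ((withPattern G α (Q n)).card : ℝ) / ((Q n).card : ℝ)) atTop (𝓝 p)

/-- `A` has propagation at most `r`, and its entries depend only on the rooted `r`-balls:
`A(x, y) = A(φ(x), φ(y))` for each isomorphism `φ` from the `r`-ball around `x` to the `r`-ball
around `φ(x)`. -/
structure IsInvariantAt (G : SimpleGraph V) (A : V → V → ℂ) (r : ℕ) : Prop where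
  propagation : ∀ x y, r < G.dist x y → A x y = 0
  invariant : ∀ (x x' : V) (φ : ballGraph G x r ≃g ballGraph G x' r),
    φ (ballRoot G x r) = ballRoot G x' r → ∀ y : rBall G x r, A x y = A x' (φ y)

/-! ### Geometry of balls -/

theorem exists_step {G : SimpleGraph V} (hG : G.Connected) {y z : V} (k : ℕ)
    (h : G.dist y z ≤ k + 1) (hne : y ≠ z) : ∃ w, G.Adj y w ∧ G.dist w z ≤ k := by
  obtain ⟨p, hp⟩ := hG.exists_walk_length_eq_dist y z
  cases p with
  | nil => exact absurd rfl hne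
  | cons hadj q =>
    rename_i w
    refine ⟨w, hadj, (SimpleGraph.dist_le q).trans ?_⟩
    rw [SimpleGraph.Walk.length_cons] at hp
    omega

theorem iso_dist_le {G : SimpleGraph V} (hG : G.Connected) {x x' : V} {R : ℕ}
    (φ : ballGraph G x R ≃g ballGraph G x' R) (k : ℕ) :
    ∀ y z : rBall G x R, G.dist x y + k ≤ R → G.dist (y : V) z ≤ k →
      G.dist (φ y : V) (φ z) ≤ k := by
  induction k with
  | zero =>
    intro y z _ h
    have : y = z := Subtype.ext ((hG.dist_eq_zero_iff).1 (by omega))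
    simp [this]
  | succ k ih =>
    intro y z hy h
    by_cases hne : (y : V) = z
    · have : y = z := Subtype.ext hne
      simp [this]
    obtain ⟨w, hadj, hw⟩ := exists_step hG k h hne
    have h1 : G.dist (y : V) w = 1 := SimpleGraph.dist_eq_one_iff_adj.2 hadj
    have h2 : G.dist x w ≤ G.dist x y + G.dist (y : V) w := hG.dist_triangle
    have hwm : w ∈ rBall G x R := by
      change G.dist x w ≤ R
      omega
    have h3 := ih ⟨w, hwm⟩ z (by change G.dist x w + k ≤ R; omega) hw
    have hadj' : (ballGraph G x' R).Adj (φ y) (φ ⟨w, hwm⟩) := φ.map_adj_iff.2 hadj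
    have h4 : G.dist (φ y : V) (φ ⟨w, hwm⟩) = 1 := SimpleGraph.dist_eq_one_iff_adj.2 hadj'
    have h5 : G.dist (φ y : V) (φ z) ≤
      G.dist (φ y : V) (φ ⟨w, hwm⟩) + G.dist (φ ⟨w, hwm⟩ : V) (φ z) := hG.dist_triangle
    omega

theorem iso_symm_root {G : SimpleGraph V} {x x' : V} {R : ℕ}
    {φ : ballGraph G x R ≃g ballGraph G x' R} (hφ : φ (ballRoot G x R) = ballRoot G x' R) :
    φ.symm (ballRoot G x' R) = ballRoot G x R := by
  rw [← hφ]; exact φ.symm_apply_apply _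

theorem iso_dist_root_le {G : SimpleGraph V} (hG : G.Connected) {x x' : V} {R : ℕ}
    (φ : ballGraph G x R ≃g ballGraph G x' R) (hφ : φ (ballRoot G x R) = ballRoot G x' R)
    (y : rBall G x R) : G.dist x' (φ y) ≤ G.dist x y := by
  have := iso_dist_le hG φ (G.dist x y) (ballRoot G x R) y
    (by have := y.2; simp only [rBall, Set.mem_ofPred_eq] at this; simpa [ballRoot] using this)
    le_rfl
  rw [hφ] at this
  exact this

theorem iso_dist_root {G : SimpleGraph V} (hG : G.Connected) {x x' : V} {R : ℕ}
    (φ : ballGraph G x R ≃g ballGraph G x' R) (hφ : φ (ballRoot G x R) = ballRoot G x' R)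
    (y : rBall G x R) : G.dist x' (φ y) = G.dist x y := by
  refine le_antisymm (iso_dist_root_le hG φ hφ y) ?_
  have := iso_dist_root_le hG φ.symm (iso_symm_root hφ) (φ y)
  rwa [φ.symm_apply_apply] at this

theorem iso_dist_le_iff {G : SimpleGraph V} (hG : G.Connected) {x x' : V} {R : ℕ}
    (φ : ballGraph G x R ≃g ballGraph G x' R) (hφ : φ (ballRoot G x R) = ballRoot G x' R)
    {k : ℕ} (y z : rBall G x R) (hy : G.dist x y + k ≤ R) :
    G.dist (φ y : V) (φ z) ≤ k ↔ G.dist (y : V) z ≤ k := by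
  refine ⟨fun h => ?_, iso_dist_le hG φ k y z hy⟩
  have := iso_dist_le hG φ.symm k (φ y) (φ z) (by rwa [iso_dist_root hG φ hφ]) h
  rwa [φ.symm_apply_apply, φ.symm_apply_apply] at this

/-- An isomorphism of rooted balls restricts to smaller balls inside. -/
theorem exists_restrict {G : SimpleGraph V} (hG : G.Connected) {x x' : V} {R : ℕ}
    (φ : ballGraph G x R ≃g ballGraph G x' R) (hφ : φ (ballRoot G x R) = ballRoot G x' R)
    {k : ℕ} (y : rBall G x R) (hy : G.dist x y + k ≤ R) :
    ∃ χ : ballGraph G y k ≃g ballGraph G (φ y) k,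
      χ (ballRoot G y k) = ballRoot G (φ y) k ∧
      ∀ (z : V) (hz : z ∈ rBall G y k) (hz' : z ∈ rBall G x R), (χ ⟨z, hz⟩ : V) = φ ⟨z, hz'⟩ := by
  have sub : ∀ z ∈ rBall G (y : V) k, z ∈ rBall G x R := fun z hz => by
    have h2 : G.dist x z ≤ G.dist x y + G.dist (y : V) z := hG.dist_triangle
    have h3 : G.dist (y : V) z ≤ k := hz
    change G.dist x z ≤ R
    omega
  have sub' : ∀ z ∈ rBall G (φ y : V) k, z ∈ rBall G x' R := fun z hz => by
    have h2 : G.dist x' z ≤ G.dist x' (φ y) + G.dist (φ y : V) z := hG.dist_triangle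
    have h3 : G.dist (φ y : V) z ≤ k := hz
    rw [iso_dist_root hG φ hφ] at h2
    change G.dist x' z ≤ R
    omega
  let e : rBall G (y : V) k ≃ rBall G (φ y : V) k :=
    { toFun := fun z => ⟨φ ⟨z, sub z z.2⟩, (iso_dist_le_iff hG φ hφ y ⟨z, sub z z.2⟩ hy).2 z.2⟩
      invFun := fun w => ⟨φ.symm ⟨w, sub' w w.2⟩,
        (iso_dist_le_iff hG φ hφ y (φ.symm ⟨w, sub' w w.2⟩) hy).1 (by
          rw [φ.apply_symm_apply]; exact w.2)⟩
      left_inv := fun z => by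
        apply Subtype.ext
        change ((φ.symm (φ ⟨z, sub z z.2⟩) : rBall G x R) : V) = z
        rw [φ.symm_apply_apply]
      right_inv := fun w => by
        apply Subtype.ext
        change ((φ (φ.symm ⟨w, sub' w w.2⟩) : rBall G x' R) : V) = w
        rw [φ.apply_symm_apply] }
  refine ⟨⟨e, ?_⟩, ?_, fun z hz hz' => rfl⟩
  · intro a b
    exact φ.map_adj_iff (v := ⟨a, sub a a.2⟩) (w := ⟨b, sub b b.2⟩)
  · exact Subtype.ext rfl

/-- The entries of a pattern-invariant matrix are preserved by isomorphisms of larger balls. -/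
theorem IsInvariantAt.apply_eq {G : SimpleGraph V} (hG : G.Connected) {A : V → V → ℂ} {r : ℕ}
    (hA : IsInvariantAt G A r) {x x' : V} {R : ℕ}
    (φ : ballGraph G x R ≃g ballGraph G x' R) (hφ : φ (ballRoot G x R) = ballRoot G x' R)
    (y z : rBall G x R) (hy : G.dist x y + r ≤ R) : A y z = A (φ y) (φ z) := by
  by_cases h : G.dist (y : V) z ≤ r
  · obtain ⟨χ, h1, h2⟩ := exists_restrict hG φ hφ y hy
    have := hA.invariant y (φ y) χ h1 ⟨z, h⟩
    rw [h2 z h z.2] at this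
    exact this
  · have h' := (iso_dist_le_iff hG φ hφ y z hy).not.2 h
    rw [hA.propagation _ _ (not_le.1 h), hA.propagation _ _ (not_le.1 h')]

theorem IsInvariantAt.mono {G : SimpleGraph V} (hG : G.Connected) {A : V → V → ℂ} {r s : ℕ}
    (hA : IsInvariantAt G A r) (h : r ≤ s) : IsInvariantAt G A s where
  propagation x y hxy := hA.propagation x y (h.trans_lt hxy)
  invariant x x' φ hφ y := by
    have := hA.apply_eq hG φ hφ (ballRoot G x s) y (by simpa [ballRoot] using h)
    rw [hφ] at this
    exact this

/-- Sums over the neighbourhood of a vertex can be transported along isomorphisms of balls. -/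
theorem finsum_transport {G : SimpleGraph V} {M : Type*} [AddCommMonoid M] {x x' : V} {R : ℕ}
    (φ : ballGraph G x R ≃g ballGraph G x' R) (f f' : V → M)
    (hf : Function.support f ⊆ rBall G x R) (hf' : Function.support f' ⊆ rBall G x' R)
    (h : ∀ z : rBall G x R, f z = f' (φ z)) : ∑ᶠ z, f z = ∑ᶠ z, f' z := by
  rw [← finsum_mem_univ f, ← finsum_mem_univ f',
    finsum_mem_inter_support_eq f Set.univ (rBall G x R)
      (by rw [Set.univ_inter, Set.inter_eq_right.2 hf]),
    finsum_mem_inter_support_eq f' Set.univ (rBall G x' R)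
      (by rw [Set.univ_inter, Set.inter_eq_right.2 hf']),
    ← finsum_set_coe_eq_finsum_mem, ← finsum_set_coe_eq_finsum_mem,
    ← finsum_comp_equiv φ.toEquiv]
  exact finsum_congr h

/-! ### Finiteness of balls and of the set of patterns -/

theorem ball_card_le {G : SimpleGraph V} (hG : G.Connected) {d : ℕ}
    (hd : ∀ x, (G.neighborSet x).encard ≤ d) (r : ℕ) :
    ∃ N : ℕ, ∀ x, ∃ S : Finset V, (S : Set V) = rBall G x r ∧ S.card ≤ N := by
  classical
  have hn : ∀ x, ∃ S : Finset V, (S : Set V) = G.neighborSet x ∧ S.card ≤ d := fun x => by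
    have hf : (G.neighborSet x).Finite := Set.finite_of_encard_le_coe (hd x)
    refine ⟨hf.toFinset, hf.coe_toFinset, ?_⟩
    have := hd x
    rw [hf.encard_eq_coe_toFinset_card] at this
    exact_mod_cast this
  choose S hS hc using hn
  induction r with
  | zero =>
    refine ⟨1, fun x => ⟨{x}, ?_, by simp⟩⟩
    ext y
    simp [rBall, hG.dist_eq_zero_iff, eq_comm]
  | succ r ih =>
    obtain ⟨N, hN⟩ := ih
    choose T hT hTc using hN
    refine ⟨1 + d * N, fun x => ⟨insert x ((S x).biUnion T), ?_, ?_⟩⟩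
    · ext y
      simp only [Finset.coe_insert, Finset.coe_biUnion, hS, hT, Set.mem_insert_iff,
        Set.mem_iUnion, SimpleGraph.mem_neighborSet, rBall, Set.mem_ofPred_eq, exists_prop]
      constructor
      · rintro (rfl | ⟨w, hw, hwy⟩)
        · simp
        · have h1 : G.dist x w = 1 := SimpleGraph.dist_eq_one_iff_adj.2 hw
          have h2 : G.dist x y ≤ G.dist x w + G.dist w y := hG.dist_triangle
          omega
      · intro h
        by_cases hxy : x = y
        · exact Or.inl hxy.symm
        · exact Or.inr (exists_step hG r h hxy)
    · refine (Finset.card_insert_le _ _).trans ?_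
      have h1 : ((S x).biUnion T).card ≤ (S x).card * N :=
        Finset.card_biUnion_le_card_mul _ _ _ fun w _ => hTc w
      have h2 : (S x).card * N ≤ d * N := Nat.mul_le_mul_right _ (hc x)
      omega

variable (G : SimpleGraph V) [hG : AQGraph G]

theorem rBall_finite (x : V) (r : ℕ) : (rBall G x r).Finite := by
  obtain ⟨d, hd⟩ := hG.bounded_degree
  obtain ⟨N, hN⟩ := ball_card_le hG.connected hd r
  obtain ⟨S, hS, -⟩ := hN x
  rw [← hS]; exact S.finite_toSet

instance pattern_finite (r : ℕ) : Finite (Pattern G r) := by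
  obtain ⟨d, hd⟩ := hG.bounded_degree
  obtain ⟨N, hN⟩ := ball_card_le hG.connected hd r
  have key : ∀ α : Pattern G r, ∃ t : (k : Fin (N + 1)) × SimpleGraph (Fin k) × Fin k,
      ∃ e : ballGraph G (Quotient.out α) r ≃g t.2.1, e (ballRoot G _ r) = t.2.2 := by
    intro α
    obtain ⟨S, hS, hc⟩ := hN (Quotient.out α)
    have e0 : rBall G (Quotient.out α) r ≃ Fin S.card :=
      (Equiv.setCongr hS.symm).trans S.equivFin
    exact ⟨⟨⟨S.card, by omega⟩, (ballGraph G (Quotient.out α) r).map e0.toEmbedding,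
      e0 (ballRoot G _ r)⟩, SimpleGraph.Iso.map e0 _, rfl⟩
  choose t ht using key
  refine Finite.of_injective t fun α β h => ?_
  obtain ⟨e, he⟩ := ht α
  have hβ := ht β
  rw [← h] at hβ
  obtain ⟨f, hf⟩ := hβ
  have hs : SamePattern G r (Quotient.out α) (Quotient.out β) :=
    ⟨e.trans f.symm, by
      change f.symm (e _) = _
      rw [he, ← hf, f.symm_apply_apply]⟩
  have : Quotient.mk (patternSetoid G r) (Quotient.out α) =
      Quotient.mk (patternSetoid G r) (Quotient.out β) := Quotient.sound hs
  rwa [Quotient.out_eq, Quotient.out_eq] at this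

/-! ### The algebra of pattern-invariant matrices -/

/-- The pattern-invariant matrices, as a space of functions `V × V → ℂ`. -/
def patternSubmodule : Submodule ℂ (V → V → ℂ) where
  carrier := {A | ∃ r, IsInvariantAt G A r}
  zero_mem' := ⟨0, fun _ _ _ => rfl, fun _ _ _ _ _ => rfl⟩
  add_mem' := by
    rintro A B ⟨r, hA⟩ ⟨s, hB⟩
    have hA' := hA.mono hG.connected (le_max_left r s)
    have hB' := hB.mono hG.connected (le_max_right r s)
    refine ⟨max r s, fun x y h => ?_, fun x x' φ hφ y => ?_⟩
    · simp [hA'.propagation x y h, hB'.propagation x y h]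
    · simp [hA'.invariant x x' φ hφ y, hB'.invariant x x' φ hφ y]
  smul_mem' := by
    rintro c A ⟨r, hA⟩
    refine ⟨r, fun x y h => ?_, fun x x' φ hφ y => ?_⟩
    · simp [hA.propagation x y h]
    · simp [hA.invariant x x' φ hφ y]

/-- The algebra `P_G` of pattern-invariant matrices. -/
def PatternAlgebra : Type u := ↥(patternSubmodule G)

namespace PatternAlgebra

noncomputable instance : AddCommGroup (PatternAlgebra G) :=
  inferInstanceAs (AddCommGroup ↥(patternSubmodule G))

noncomputable instance : Module ℂ (PatternAlgebra G) :=
  inferInstanceAs (Module ℂ ↥(patternSubmodule G))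

/-- The entries `A(x, y)`. -/
instance : CoeFun (PatternAlgebra G) (fun _ => V → V → ℂ) := ⟨fun A => A.1⟩

variable {G}

@[ext] theorem ext {A B : PatternAlgebra G} (h : ∀ x y, A x y = B x y) : A = B :=
  Subtype.ext (funext fun x => funext fun y => h x y)

theorem exists_invariantAt (A : PatternAlgebra G) : ∃ r, IsInvariantAt G A r := A.2

@[simp] theorem zero_apply (x y : V) : (0 : PatternAlgebra G) x y = 0 := rfl
@[simp] theorem add_apply (A B : PatternAlgebra G) (x y : V) : (A + B) x y = A x y + B x y := rfl
@[simp] theorem neg_apply (A : PatternAlgebra G) (x y : V) : (-A) x y = -A x y := rfl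
@[simp] theorem smul_apply (c : ℂ) (A : PatternAlgebra G) (x y : V) :
    (c • A) x y = c * A x y := rfl

theorem finite_row (A : PatternAlgebra G) (x : V) : (Function.support (A x)).Finite := by
  obtain ⟨r, hr⟩ := A.exists_invariantAt
  refine (rBall_finite G x r).subset fun y hy => ?_
  by_contra h
  exact hy (hr.propagation x y (not_le.1 h))

theorem finite_col (A : PatternAlgebra G) (y : V) :
    (Function.support fun x => A x y).Finite := by
  obtain ⟨r, hr⟩ := A.exists_invariantAt
  refine (rBall_finite G y r).subset fun x hx => ?_
  by_contra h
  refine hx (hr.propagation x y (not_le.1 ?_))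
  rw [SimpleGraph.dist_comm]; exact h

/-- The product `(AB)(x, y) = ∑_z A(x, z) B(z, y)`. -/
noncomputable instance : Mul (PatternAlgebra G) where
  mul A B := ⟨fun x y => ∑ᶠ z, A x z * B z y, by
    obtain ⟨r, hA⟩ := A.exists_invariantAt
    obtain ⟨s, hB⟩ := B.exists_invariantAt
    have hc := hG.connected
    have hA' := hA.mono hc (Nat.le_add_right r s)
    refine ⟨r + s, fun x y hxy => ?_, fun x x' φ hφ y => ?_⟩
    · refine finsum_eq_zero_of_forall_eq_zero fun z => ?_
      by_cases h : r < G.dist x z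
      · rw [hA.propagation x z h, zero_mul]
      · have : G.dist x y ≤ G.dist x z + G.dist z y := hc.dist_triangle
        rw [hB.propagation z y (by omega), mul_zero]
    · refine finsum_transport φ _ _ (fun z hz => ?_) (fun z hz => ?_) fun z => ?_
      · by_contra h
        exact hz (by simp [hA'.propagation x z (not_le.1 h)])
      · by_contra h
        exact hz (by simp [hA'.propagation x' z (not_le.1 h)])
      · rw [hA'.invariant x x' φ hφ z]
        by_cases h : G.dist x z ≤ r
        · rw [hB.apply_eq hc φ hφ z y (by omega)]
        · have h' : ¬ G.dist x' (φ z) ≤ r := by rwa [iso_dist_root hc φ hφ]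
          rw [hA.propagation x' _ (not_le.1 h'), zero_mul, zero_mul]⟩

theorem mul_apply (A B : PatternAlgebra G) (x y : V) :
    (A * B) x y = ∑ᶠ z, A x z * B z y := rfl

open scoped Classical in
/-- The identity matrix. -/
noncomputable instance : One (PatternAlgebra G) where
  one := ⟨fun x y => if x = y then 1 else 0, 0, fun x y h => by
    have : x ≠ y := by rintro rfl; simp at h
    simp [this], fun x x' φ hφ y => by
    have : x = y ↔ x' = φ y := by
      have h1 : x = y ↔ ballRoot G x 0 = y := (Subtype.ext_iff (a1 := ballRoot G x 0) (a2 := y)).symm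
      have h2 : x' = φ y ↔ ballRoot G x' 0 = φ y :=
        (Subtype.ext_iff (a1 := ballRoot G x' 0) (a2 := φ y)).symm
      rw [h1, h2, ← hφ, φ.injective.eq_iff]
    simp [this]⟩

open scoped Classical in
theorem one_apply (x y : V) : (1 : PatternAlgebra G) x y = if x = y then 1 else 0 := rfl

/-- The adjoint matrix `A^*(x, y) = conj A(y, x)`. -/
noncomputable instance : Star (PatternAlgebra G) where
  star A := ⟨fun x y => star (A y x), by
    obtain ⟨r, hA⟩ := A.exists_invariantAt
    have hc := hG.connected
    refine ⟨r + r, fun x y hxy => ?_, fun x x' φ hφ y => ?_⟩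
    · rw [hA.propagation y x (by rw [SimpleGraph.dist_comm]; omega), star_zero]
    · congr 1
      by_cases h : G.dist x y ≤ r
      · have := hA.apply_eq hc φ hφ y (ballRoot G x _) (by omega)
        rw [hφ] at this
        exact this
      · have h' : ¬ G.dist x' (φ y) ≤ r := by rwa [iso_dist_root hc φ hφ]
        rw [SimpleGraph.dist_comm] at h h'
        rw [hA.propagation _ _ (not_le.1 h), hA.propagation _ _ (not_le.1 h')]⟩

theorem star_apply (A : PatternAlgebra G) (x y : V) : (star A) x y = star (A y x) := rfl

/-- The action of a pattern-invariant matrix on functions, `(A f)(x) = ∑_y A(x, y) f(y)`. -/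
noncomputable def mulVec (A : PatternAlgebra G) (f : V → ℂ) (x : V) : ℂ := ∑ᶠ y, A x y * f y

theorem mulVec_eq_sum (A : PatternAlgebra G) (f : V → ℂ) (x : V) {S : Finset V}
    (hS : Function.support (A x) ⊆ S) : A.mulVec f x = ∑ y ∈ S, A x y * f y :=
  finsum_eq_sum_of_support_subset _ fun y hy => hS fun h => hy (by simp [h])

theorem mul_apply' (A B : PatternAlgebra G) (x y : V) :
    (A * B) x y = A.mulVec (fun z => B z y) x := rfl

theorem mulVec_add (A : PatternAlgebra G) (f g : V → ℂ) (x : V) :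
    A.mulVec (fun y => f y + g y) x = A.mulVec f x + A.mulVec g x := by
  have hS : Function.support (A x) ⊆ (A.finite_row x).toFinset := by simp
  simp only [A.mulVec_eq_sum _ x hS, mul_add, Finset.sum_add_distrib]

theorem mulVec_smul (A : PatternAlgebra G) (c : ℂ) (f : V → ℂ) (x : V) :
    A.mulVec (fun y => c * f y) x = c * A.mulVec f x := by
  have hS : Function.support (A x) ⊆ (A.finite_row x).toFinset := by simp
  simp only [A.mulVec_eq_sum _ x hS, Finset.mul_sum, mul_left_comm]

theorem add_mulVec (A B : PatternAlgebra G) (f : V → ℂ) (x : V) :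
    (A + B).mulVec f x = A.mulVec f x + B.mulVec f x := by
  unfold mulVec
  rw [← finsum_add_distrib]
  · exact finsum_congr fun y => by rw [add_apply, add_mul]
  · exact (A.finite_row x).subset fun y hy h => hy (by simp [h])
  · exact (B.finite_row x).subset fun y hy h => hy (by simp [h])

theorem smul_mulVec (c : ℂ) (A : PatternAlgebra G) (f : V → ℂ) (x : V) :
    (c • A).mulVec f x = c * A.mulVec f x := by
  unfold mulVec
  rw [mul_finsum]
  · exact finsum_congr fun y => by rw [smul_apply, mul_assoc]

theorem mul_mulVec (A B : PatternAlgebra G) (f : V → ℂ) (x : V) :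
    (A * B).mulVec f x = A.mulVec (B.mulVec f) x := by
  classical
  set S := (A.finite_row x).toFinset
  set T := S.biUnion fun z => (B.finite_row z).toFinset
  have hS : Function.support (A x) ⊆ S := by simp [S]
  have hB : ∀ z ∈ S, Function.support (B z) ⊆ T := fun z hz y hy => by
    simp only [T, Finset.coe_biUnion, Set.mem_iUnion]
    exact ⟨z, hz, by simpa using hy⟩
  have hAB : ∀ y, (A * B) x y = ∑ z ∈ S, A x z * B z y := fun y =>
    A.mulVec_eq_sum (fun z => B z y) x hS
  have hT : Function.support ((A * B) x) ⊆ T := fun y hy => by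
    by_contra h
    refine hy ?_
    rw [hAB]
    refine Finset.sum_eq_zero fun z hz => ?_
    have : B z y = 0 := by
      by_contra h'
      exact h (hB z hz h')
    rw [this, mul_zero]
  rw [mulVec_eq_sum _ _ _ hT, mulVec_eq_sum _ _ _ hS]
  simp only [hAB, Finset.sum_mul]
  rw [Finset.sum_comm]
  refine Finset.sum_congr rfl fun z hz => ?_
  rw [B.mulVec_eq_sum f z (hB z hz), Finset.mul_sum]
  simp only [mul_assoc]

theorem one_mulVec (f : V → ℂ) (x : V) : (1 : PatternAlgebra G).mulVec f x = f x := by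
  classical
  unfold mulVec
  rw [finsum_eq_single _ x]
  · simp [one_apply]
  · intro y hy
    simp [one_apply, hy.symm]

noncomputable instance : Ring (PatternAlgebra G) :=
  { (inferInstance : AddCommGroup (PatternAlgebra G)) with
    mul_assoc := fun A B C => by ext x y; exact mul_mulVec A B _ x
    one_mul := fun A => by ext x y; exact one_mulVec _ x
    mul_one := fun A => by
      classical
      ext x y
      rw [mul_apply, finsum_eq_single _ y]
      · simp [one_apply]
      · intro z hz
        simp [one_apply, hz]
    left_distrib := fun A B C => by ext x y; exact mulVec_add A _ _ x
    right_distrib := fun A B C => by ext x y; exact add_mulVec A B _ x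
    zero_mul := fun A => by ext x y; simp [mul_apply]
    mul_zero := fun A => by ext x y; simp [mul_apply] }

noncomputable instance : Algebra ℂ (PatternAlgebra G) :=
  Algebra.ofModule (fun c A B => by ext x y; exact smul_mulVec c A _ x)
    (fun c A B => by ext x y; exact mulVec_smul A c _ x)

noncomputable instance : StarRing (PatternAlgebra G) where
  star_involutive A := by ext x y; simp [star_apply]
  star_add A B := by ext x y; simp [star_apply]
  star_mul A B := by
    ext x y
    rw [star_apply, mul_apply, mul_apply, ← starAddEquiv_apply, AddEquiv.map_finsum]
    exact finsum_congr fun z => by simp [star_apply, mul_comm]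

instance : StarModule ℂ (PatternAlgebra G) where
  star_smul c A := by ext x y; simp [star_apply]

/-! ### Boundedness on `L²(V)` -/

theorem exists_rowSum_le (A : PatternAlgebra G) :
    ∃ C : ℝ, 0 ≤ C ∧ ∀ (x : V) (S : Finset V), ∑ y ∈ S, ‖A x y‖ ≤ C := by
  obtain ⟨r, hA⟩ := A.exists_invariantAt
  have key : ∀ x x', patternOf G r x = patternOf G r x' →
      ∑ᶠ y, ‖A x y‖ = ∑ᶠ y, ‖A x' y‖ := fun x x' h => by
    obtain ⟨φ, hφ⟩ : SamePattern G r x x' := Quotient.exact h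
    refine finsum_transport φ _ _ (fun z hz => ?_) (fun z hz => ?_) fun z => ?_
    · by_contra h
      exact hz (by simp [hA.propagation x z (not_le.1 h)])
    · by_contra h
      exact hz (by simp [hA.propagation x' z (not_le.1 h)])
    · rw [hA.invariant x x' φ hφ z]
  obtain ⟨C, hC⟩ := (Set.finite_range fun α : Pattern G r =>
    ∑ᶠ y, ‖A (Quotient.out α) y‖).bddAbove
  have hle : ∀ (x : V) (S : Finset V), ∑ y ∈ S, ‖A x y‖ ≤ C := fun x S => by
    have h1 : ∑ᶠ y, ‖A x y‖ ≤ C := by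
      rw [key x (Quotient.out (patternOf G r x)) (Quotient.out_eq _).symm]
      exact hC ⟨patternOf G r x, rfl⟩
    refine le_trans ?_ h1
    have h2 : (Function.support fun y => ‖A x y‖).Finite :=
      (A.finite_row x).subset fun y hy h => hy (by simp [h])
    classical
    rw [finsum_eq_sum_of_support_subset _
      (show (Function.support fun y => ‖A x y‖) ⊆ ((h2.toFinset ∪ S : Finset V) : Set V) by simp)]
    exact Finset.sum_le_sum_of_subset_of_nonneg Finset.subset_union_right
      fun _ _ _ => norm_nonneg _
  obtain ⟨Q, hQ⟩ := hG.amenable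
  obtain ⟨x, -⟩ := hQ.nonempty 0
  exact ⟨C, by simpa using hle x ∅, hle⟩

theorem exists_bound (A : PatternAlgebra G) :
    ∃ C : ℝ, 0 ≤ C ∧ ∀ (f : V → ℂ) (F : Finset V), ∃ T : Finset V,
      ∑ x ∈ F, ‖A.mulVec f x‖ ^ 2 ≤ C * ∑ y ∈ T, ‖f y‖ ^ 2 := by
  classical
  obtain ⟨C, hC0, hC⟩ := A.exists_rowSum_le
  obtain ⟨D, hD0, hD⟩ := (star A).exists_rowSum_le
  refine ⟨C * D, mul_nonneg hC0 hD0, fun f F => ?_⟩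
  set T := F.biUnion fun z => (A.finite_row z).toFinset
  have hT : ∀ z ∈ F, Function.support (A z) ⊆ T := fun z hz y hy => by
    simp only [T, Finset.coe_biUnion, Set.mem_iUnion]
    exact ⟨z, hz, by simpa using hy⟩
  refine ⟨T, ?_⟩
  have h1 : ∀ x ∈ F, ‖A.mulVec f x‖ ^ 2 ≤ C * ∑ y ∈ T, ‖A x y‖ * ‖f y‖ ^ 2 := fun x hx => by
    rw [A.mulVec_eq_sum f x (hT x hx)]
    calc ‖∑ y ∈ T, A x y * f y‖ ^ 2 ≤ (∑ y ∈ T, ‖A x y‖ * ‖f y‖) ^ 2 := by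
          gcongr
          exact (norm_sum_le _ _).trans_eq (by simp)
      _ ≤ (∑ y ∈ T, ‖A x y‖) * ∑ y ∈ T, ‖A x y‖ * ‖f y‖ ^ 2 :=
          Finset.sum_sq_le_sum_mul_sum_of_sq_le_mul _ (fun _ _ => norm_nonneg _)
            (fun _ _ => by positivity) (fun _ _ => le_of_eq (by ring))
      _ ≤ _ := by
          gcongr
          exact hC x T
  calc ∑ x ∈ F, ‖A.mulVec f x‖ ^ 2 ≤ ∑ x ∈ F, C * ∑ y ∈ T, ‖A x y‖ * ‖f y‖ ^ 2 :=
        Finset.sum_le_sum h1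
    _ = C * ∑ y ∈ T, (∑ x ∈ F, ‖A x y‖) * ‖f y‖ ^ 2 := by
        rw [← Finset.mul_sum, Finset.sum_comm]
        simp only [Finset.sum_mul]
    _ ≤ C * ∑ y ∈ T, D * ‖f y‖ ^ 2 := by
        gcongr with y hy
        simpa [star_apply] using hD y F
    _ = C * D * ∑ y ∈ T, ‖f y‖ ^ 2 := by rw [← Finset.mul_sum, mul_assoc]

/-- `P_G` acts on `L²(V)` by bounded operators, `(A f)(x) = ∑_y A(x, y) f(y)`. -/
theorem exists_l2Bound (A : PatternAlgebra G) :
    ∃ C : ℝ, 0 ≤ C ∧ ∀ (f : lp (fun _ : V => ℂ) 2) (F : Finset V),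
      ∑ x ∈ F, ‖A.mulVec f x‖ ^ 2 ≤ (C * ‖f‖) ^ 2 := by
  obtain ⟨C, hC, h⟩ := A.exists_bound
  refine ⟨√C, Real.sqrt_nonneg _, fun f F => ?_⟩
  obtain ⟨T, hT⟩ := h f F
  rw [mul_pow, Real.sq_sqrt hC]
  refine hT.trans ?_
  gcongr
  simpa using lp.sum_rpow_le_norm_rpow (p := 2) (by simp) f T

/-- The bounded operator on `L²(V)` given by a pattern-invariant matrix,
`(A f)(x) = ∑_y A(x, y) f(y)`. -/
noncomputable def l2Operator (A : PatternAlgebra G) :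
    lp (fun _ : V => ℂ) 2 →L[ℂ] lp (fun _ : V => ℂ) 2 :=
  LinearMap.mkContinuousOfExistsBound
    { toFun := fun f => ⟨A.mulVec f, by
        obtain ⟨C, -, h⟩ := A.exists_l2Bound
        exact memℓp_gen' (C := (C * ‖f‖) ^ 2) fun F => by simpa using h f F⟩
      map_add' := fun f g => by
        ext x
        exact mulVec_add A f g x
      map_smul' := fun c f => by
        ext x
        exact mulVec_smul A c f x }
    (by
      obtain ⟨C, hC, h⟩ := A.exists_l2Bound
      exact ⟨C, fun f => lp.norm_le_of_forall_sum_le (by simp) (by positivity)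
        fun F => by simpa using h f F⟩)

theorem l2Operator_apply (A : PatternAlgebra G) (f : lp (fun _ : V => ℂ) 2) (x : V) :
    A.l2Operator f x = ∑ᶠ y, A x y * f y := rfl

end PatternAlgebra

/-! ### The trace on `P_G` and the pattern-frequency algebra -/

namespace PatternAlgebra

variable {G}

/-- The mean diagonal entry of `A` over a finite vertex set. -/
noncomputable def mean (A : PatternAlgebra G) (Q : Finset V) : ℂ :=
  (∑ x ∈ Q, A x x) / (Q.card : ℂ)

theorem exists_trace (A : PatternAlgebra G) :
    ∃ t : ℂ, ∀ Q : ℕ → Finset V, IsFolner G Q →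
      Tendsto (fun n => A.mean (Q n)) atTop (𝓝 t) := by
  classical
  obtain ⟨r, hA⟩ := A.exists_invariantAt
  have := Fintype.ofFinite (Pattern G r)
  choose p hp using hG.frequency r
  have key : ∀ x, A x x = A (Quotient.out (patternOf G r x)) (Quotient.out (patternOf G r x)) := by
    intro x
    obtain ⟨φ, hφ⟩ : SamePattern G r x (Quotient.out (patternOf G r x)) :=
      Quotient.exact (Quotient.out_eq (patternOf G r x)).symm
    have := hA.invariant _ _ φ hφ (ballRoot G x r)
    rw [hφ] at this
    exact this
  refine ⟨∑ α, (p α : ℂ) * A (Quotient.out α) (Quotient.out α), fun Q hQ => ?_⟩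
  have hm : ∀ n, A.mean (Q n) = ∑ α : Pattern G r,
      ((((withPattern G α (Q n)).card : ℝ) / ((Q n).card : ℝ) : ℝ) : ℂ) *
        A (Quotient.out α) (Quotient.out α) := fun n => by
    unfold mean
    rw [← Finset.sum_fiberwise (Q n) (patternOf G r) (fun x => A x x), Finset.sum_div]
    refine Finset.sum_congr rfl fun α _ => ?_
    have : ∑ x ∈ Q n with patternOf G r x = α, A x x =
        ((withPattern G α (Q n)).card : ℂ) * A (Quotient.out α) (Quotient.out α) := by
      rw [← nsmul_eq_mul]
      unfold withPattern
      refine (Finset.sum_congr rfl fun x hx => ?_).trans (Finset.sum_const _)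
      rw [key x, (Finset.mem_filter.1 hx).2]
    rw [this]
    push_cast
    ring
  simp only [hm]
  refine tendsto_finsetSum _ fun α _ => Tendsto.mul_const _ ?_
  exact (Complex.continuous_ofReal.tendsto _).comp (hp α Q hQ)

/-- The limit `lim |Q_n|⁻¹ ∑_{x ∈ Q_n} A(x, x)`, where `(Q_n)` is any Følner sequence. -/
noncomputable def traceAux (A : PatternAlgebra G) : ℂ := Classical.choose A.exists_trace

theorem tendsto_traceAux (A : PatternAlgebra G) {Q : ℕ → Finset V} (hQ : IsFolner G Q) :
    Tendsto (fun n => A.mean (Q n)) atTop (𝓝 A.traceAux) :=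
  Classical.choose_spec A.exists_trace Q hQ

variable (G) in
/-- The trace `Tr_G` on `P_G`. -/
noncomputable def trace : PatternAlgebra G →ₗ[ℂ] ℂ where
  toFun := traceAux
  map_add' A B := by
    obtain ⟨Q, hQ⟩ := hG.amenable
    refine tendsto_nhds_unique (tendsto_traceAux _ hQ)
      (((tendsto_traceAux A hQ).add (tendsto_traceAux B hQ)).congr fun n => ?_)
    simp [mean, Finset.sum_add_distrib, add_div]
  map_smul' c A := by
    obtain ⟨Q, hQ⟩ := hG.amenable
    refine tendsto_nhds_unique (tendsto_traceAux _ hQ)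
      (((tendsto_traceAux A hQ).const_mul c).congr fun n => ?_)
    simp [mean, ← Finset.mul_sum, mul_div_assoc]

theorem tendsto_trace (A : PatternAlgebra G) {Q : ℕ → Finset V} (hQ : IsFolner G Q) :
    Tendsto (fun n => (∑ x ∈ Q n, A x x) / ((Q n).card : ℂ)) atTop (𝓝 (trace G A)) :=
  tendsto_traceAux A hQ

theorem trace_star (A : PatternAlgebra G) : trace G (star A) = star (trace G A) := by
  obtain ⟨Q, hQ⟩ := hG.amenable
  refine tendsto_nhds_unique (tendsto_trace _ hQ)
    (((continuous_star.tendsto _).comp (tendsto_trace A hQ)).congr fun n => ?_)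
  simp [star_apply]

theorem trace_re_mono {A B : PatternAlgebra G} (h : ∀ x, (A x x).re ≤ (B x x).re) :
    (trace G A).re ≤ (trace G B).re := by
  obtain ⟨Q, hQ⟩ := hG.amenable
  refine le_of_tendsto_of_tendsto' ((Complex.continuous_re.tendsto _).comp (tendsto_trace A hQ))
    ((Complex.continuous_re.tendsto _).comp (tendsto_trace B hQ)) fun n => ?_
  simp only [Function.comp_apply, Complex.div_natCast_re, Complex.re_sum]
  refine div_le_div_of_nonneg_right (Finset.sum_le_sum fun x _ => h x) (Nat.cast_nonneg _)

theorem star_mul_self_apply (A : PatternAlgebra G) (x : V) {S : Finset V}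
    (hS : (Function.support fun z => A z x) ⊆ S) :
    ((star A * A) x x).re = ∑ z ∈ S, ‖A z x‖ ^ 2 := by
  rw [mul_apply, finsum_eq_sum_of_support_subset (s := S) _ fun z hz => hS fun h => hz (by simp [h]),
    Complex.re_sum]
  refine Finset.sum_congr rfl fun z _ => ?_
  rw [star_apply, Complex.star_def, mul_comm, Complex.mul_conj, Complex.ofReal_re,
    Complex.normSq_eq_norm_sq]

/-- The (possibly degenerate) inner product `Tr_G(A^* B)` on `P_G`. -/
noncomputable abbrev preInnerCore : PreInnerProductSpace.Core ℂ (PatternAlgebra G) where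
  inner A B := trace G (star A * B)
  conj_inner_symm A B := by
    rw [← Complex.star_def, ← trace_star, star_mul, star_star]
  re_inner_nonneg A := by
    have := trace_re_mono (A := 0) (B := star A * A) fun x => by
      rw [A.star_mul_self_apply x (S := (A.finite_col x).toFinset) (by simp)]
      simpa using Finset.sum_nonneg fun _ _ => by positivity
    simpa using this
  add_left A B C := by rw [star_add, add_mul, map_add]
  smul_left A B c := by simp

noncomputable instance : SeminormedAddCommGroup (PatternAlgebra G) :=
  InnerProductSpace.Core.toSeminormedAddCommGroup (c := preInnerCore)

noncomputable instance : InnerProductSpace ℂ (PatternAlgebra G) :=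
  InnerProductSpace.ofCore preInnerCore

theorem inner_def (A B : PatternAlgebra G) : inner ℂ A B = trace G (star A * B) := rfl

theorem norm_sq_def (A : PatternAlgebra G) : ‖A‖ ^ 2 = (trace G (star A * A)).re := by
  rw [← inner_def, ← inner_self_eq_norm_sq (𝕜 := ℂ)]; rfl

theorem exists_leftMul_bound (A : PatternAlgebra G) :
    ∃ C : ℝ, ∀ X : PatternAlgebra G, ‖A * X‖ ≤ C * ‖X‖ := by
  classical
  obtain ⟨C, hC, h⟩ := A.exists_bound
  refine ⟨√C, fun X => ?_⟩
  rw [← sq_le_sq₀ (norm_nonneg _) (by positivity), mul_pow, Real.sq_sqrt hC, norm_sq_def,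
    norm_sq_def]
  have := trace_re_mono (A := star (A * X) * (A * X)) (B := (C : ℂ) • (star X * X)) fun x => by
    obtain ⟨T, hT⟩ := h (fun z => X z x) ((A * X).finite_col x).toFinset
    rw [star_mul_self_apply (A * X) x (S := ((A * X).finite_col x).toFinset) (by simp),
      smul_apply, Complex.re_ofReal_mul,
      X.star_mul_self_apply x (S := T ∪ (X.finite_col x).toFinset) (by simp)]
    refine (hT.trans ?_)
    gcongr
    exact Finset.subset_union_left
  simpa using this

/-- Left multiplication `L_A` on the pre-Hilbert space `P_G`. -/
noncomputable def leftMul (A : PatternAlgebra G) : PatternAlgebra G →L[ℂ] PatternAlgebra G :=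
  LinearMap.mkContinuousOfExistsBound (LinearMap.mulLeft ℂ A) A.exists_leftMul_bound

@[simp] theorem leftMul_apply (A X : PatternAlgebra G) : A.leftMul X = A * X := rfl

end PatternAlgebra

open UniformSpace (Completion)

/-- The Hilbert space of the GNS construction: the (separated) completion of `P_G` with respect
to the inner product `Tr_G(A^* B)`. -/
abbrev GNSSpace : Type u := Completion (PatternAlgebra G)

variable {G} in
theorem clm_ext {S T : GNSSpace G →L[ℂ] GNSSpace G}
    (h : ∀ X : PatternAlgebra G, S X = T X) : S = T := by
  ext x
  induction x using Completion.induction_on with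
  | hp => exact isClosed_eq S.continuous T.continuous
  | ih a => exact h a

/-- The representation `ψ_G` of `P_G` by left multiplication on its GNS space. -/
noncomputable def gnsRep : PatternAlgebra G →⋆ₐ[ℂ] (GNSSpace G →L[ℂ] GNSSpace G) where
  toFun A := A.leftMul.completion
  map_one' := clm_ext fun X => by simp
  map_mul' A B := clm_ext fun X => by simp [mul_assoc]
  map_zero' := clm_ext fun X => by simp [Completion.coe_zero]
  map_add' A B := clm_ext fun X => by simp [add_mul, Completion.coe_add]
  commutes' c := clm_ext fun X => by simp [Algebra.algebraMap_eq_smul_one]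
  map_star' A := by
    refine (ContinuousLinearMap.eq_adjoint_iff _ _).mpr fun x y => ?_
    induction x, y using Completion.induction_on₂ with
    | hp => apply isClosed_eq <;> fun_prop
    | ih x y => simp [mul_assoc, PatternAlgebra.inner_def]

theorem gnsRep_apply_coe (A X : PatternAlgebra G) :
    gnsRep G A (X : GNSSpace G) = ((A * X : PatternAlgebra G) : GNSSpace G) := by
  change A.leftMul.completion _ = _
  simp

/-- The pattern-frequency algebra `N_G`: the closure of `ψ_G(P_G)` in the weak operator
topology. -/
def patternFrequencyAlgebra : Set (GNSSpace G →L[ℂ] GNSSpace G) :=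
  {T | ContinuousLinearMapWOT.ofCLM T ∈ closure (Set.range fun A : PatternAlgebra G =>
    (ContinuousLinearMapWOT.ofCLM (gnsRep G A) : GNSSpace G →WOT[ℂ] GNSSpace G))}

/-- The trace `Tr_G(T) = ⟨T 1, 1⟩` on `N_G`, where `1` is the class of the identity matrix. (The
inner product of Mathlib is linear in the second variable.) -/
noncomputable def vnTrace (T : patternFrequencyAlgebra G) : ℂ :=
  inner ℂ ((1 : PatternAlgebra G) : GNSSpace G) (T.1 ((1 : PatternAlgebra G) : GNSSpace G))

theorem gnsRep_mem (A : PatternAlgebra G) : gnsRep G A ∈ patternFrequencyAlgebra G :=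
  subset_closure ⟨A, rfl⟩

/-- On `P_G` the trace of `N_G` is the trace of `P_G`. -/
theorem vnTrace_gnsRep (A : PatternAlgebra G) :
    vnTrace G ⟨gnsRep G A, gnsRep_mem G A⟩ = PatternAlgebra.trace G A := by
  unfold vnTrace
  rw [gnsRep_apply_coe, Completion.inner_coe, PatternAlgebra.inner_def, star_one, one_mul, mul_one]

theorem norm_one_sub_le {H : Type*} [NormedAddCommGroup H] [InnerProductSpace ℂ H]
    [CompleteSpace H] (T : H →L[ℂ] H) :
    ‖1 - (((‖T‖ ^ 2 + 1)⁻¹ : ℝ) : ℂ) • (star T * T)‖ ≤ 1 := by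
  set c : ℝ := (‖T‖ ^ 2 + 1)⁻¹ with hc
  have hc0 : 0 < c := by positivity
  have hc1 : c * ‖T‖ ^ 2 ≤ 1 := by
    rw [hc, inv_mul_le_iff₀ (by positivity)]; linarith
  refine ContinuousLinearMap.opNorm_le_bound _ zero_le_one fun x => ?_
  rw [one_mul, ← sq_le_sq₀ (norm_nonneg _) (norm_nonneg _)]
  have h1 : inner ℂ x ((star T * T) x) = ((‖T x‖ ^ 2 : ℝ) : ℂ) := by
    rw [mul_apply_eq_comp, ContinuousLinearMap.star_eq_adjoint,
      ContinuousLinearMap.adjoint_inner_right, inner_self_eq_norm_sq_to_K]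
    simp
  have h2 : ‖(star T * T) x‖ ^ 2 ≤ ‖T‖ ^ 2 * ‖T x‖ ^ 2 := by
    rw [← mul_pow]
    gcongr
    rw [mul_apply_eq_comp, ContinuousLinearMap.star_eq_adjoint]
    refine (ContinuousLinearMap.le_opNorm _ _).trans_eq ?_
    rw [← ContinuousLinearMap.star_eq_adjoint, norm_star]
  have h3 : ‖(1 - (c : ℂ) • (star T * T)) x‖ ^ 2 =
      ‖x‖ ^ 2 - 2 * c * ‖T x‖ ^ 2 + c ^ 2 * ‖(star T * T) x‖ ^ 2 := by
    rw [sub_apply, smul_apply,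
      one_apply_eq_self, norm_sub_sq (𝕜 := ℂ), inner_smul_right, h1, norm_smul,
      ← Complex.ofReal_mul, RCLike.re_eq_complex_re, Complex.ofReal_re, Complex.norm_real,
      Real.norm_of_nonneg hc0.le]
    ring
  rw [h3]
  have h4 : c ^ 2 * ‖(star T * T) x‖ ^ 2 ≤ c * ‖T x‖ ^ 2 := by
    calc c ^ 2 * ‖(star T * T) x‖ ^ 2 ≤ c ^ 2 * (‖T‖ ^ 2 * ‖T x‖ ^ 2) := by gcongr
      _ = c * (c * ‖T‖ ^ 2) * ‖T x‖ ^ 2 := by ring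
      _ ≤ c * 1 * ‖T x‖ ^ 2 := by gcongr
      _ = c * ‖T x‖ ^ 2 := by ring
  have : 0 ≤ c * ‖T x‖ ^ 2 := by positivity
  nlinarith

/-- The projection onto the kernel of `ψ_G(B)` belongs to `N_G`. -/
theorem kernel_starProjection_mem (B : PatternAlgebra G) :
    (gnsRep G B).ker.starProjection ∈ patternFrequencyAlgebra G := by
  set T := gnsRep G B with hT
  set c : ℝ := (‖T‖ ^ 2 + 1)⁻¹ with hc
  have hc0 : (c : ℂ) ≠ 0 := by
    have : 0 < c := by positivity
    exact_mod_cast this.ne'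
  have hc0' : c ≠ 0 := by exact_mod_cast hc0
  set a : PatternAlgebra G := 1 - (c : ℂ) • (star B * B)
  set f := gnsRep G a with hf
  have hfT : f = 1 - (c : ℂ) • (star T * T) := by
    rw [hf, hT, map_sub, map_one, map_smul, map_mul, map_star]
  have hker : f.eqLocus (1 : GNSSpace G →L[ℂ] GNSSpace G) = T.ker := by
    rw [← ContinuousLinearMap.ker_adjoint_comp_self T]
    ext x
    rw [LinearMap.mem_eqLocus, hfT]
    simp [hc0', ContinuousLinearMap.star_eq_adjoint]
  have herg := f.tendsto_birkhoffAverage_orthogonalProjection (hfT ▸ norm_one_sub_le T)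
  have hproj : ∀ x, ((f.eqLocus (1 : GNSSpace G →L[ℂ] GNSSpace G)).orthogonalProjectionOnto x :
      GNSSpace G) = T.ker.starProjection x := fun x => by
    simp only [← hker]; rfl
  have hlim : Tendsto (fun n : ℕ => (ContinuousLinearMapWOT.ofCLM
      (gnsRep G ((n : ℂ)⁻¹ • ∑ k ∈ Finset.range n, a ^ k)) : GNSSpace G →WOT[ℂ] GNSSpace G))
      atTop (𝓝 (ContinuousLinearMapWOT.ofCLM T.ker.starProjection)) := by
    rw [ContinuousLinearMapWOT.tendsto_iff_forall_dual_apply_tendsto]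
    intro x y
    have h := (y.continuous.tendsto _).comp (herg x)
    rw [hproj] at h
    refine h.congr fun n => ?_
    simp [birkhoffAverage, birkhoffSum, hf]
  exact mem_closure_of_tendsto hlim (Eventually.of_forall fun n => ⟨_, rfl⟩)

/-- The orthogonal projection onto the kernel of `ψ_G(B)`, as an element of `N_G`. If `B` is
positive, then so is `ψ_G(B)`, and this is the spectral projection `E_0^B = χ_{[0,0]}(ψ_G(B))`. -/
noncomputable def kernelProjection (B : PatternAlgebra G) : patternFrequencyAlgebra G :=
  ⟨(gnsRep G B).ker.starProjection, kernel_starProjection_mem G B⟩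

/-- The finite truncation `B_n = p_Q B i_Q`, a complex matrix indexed by `Q`. -/
def truncation {G : SimpleGraph V} [AQGraph G] (B : PatternAlgebra G) (Q : Finset V) :
    Matrix Q Q ℂ :=
  Matrix.of fun x y => B x y

end QuasiCrystal

namespace QuasiCrystal

universe u

/-! ### Finite Hermitian matrices -/

/-! This is Lück's approximation argument. Scaling by a common denominator changes no kernel, and
`B` has only finitely many distinct entries, so integer entries may be assumed. Positivity enters
through self-adjointness: each truncation `B_n` is Hermitian, and uniformly bounded row sums put all
eigenvalues in an interval `[-K, K]` independent of `n`.

The indicator of `{0}` is approximated by the polynomials `p_N(x) = N⁻¹ ∑_{k < N} (1 - c x²)^k`. For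
fixed `N`, the normalized traces of `p_N(B_n)` converge to `Tr_G(p_N(B))`: entries of `p_N(B_n)` and
`p_N(B)` agree away from a collar of the boundary, and collars are negligible along a Følner
sequence (`tendsto_trace_aeval_truncation`). As `N → ∞`, the mean ergodic theorem in the GNS space
gives `Tr_G(p_N(B)) → Tr_G(E_0^B)` (`tendsto_trace_kernelPoly`).

Exchanging the two limits requires that the trace of `p_N(B_n)` exceed the kernel dimension by
little, uniformly in `n`; the danger is an accumulation of small nonzero eigenvalues. Integrality
excludes it: the product of the nonzero eigenvalues is, up to sign, a nonzero coefficient of an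
integer polynomial, so the sum of their logarithms is nonnegative. Since `p_N(x) ≤ δ (1 + log K -
log |x|)` for large `N` and `0 < |x| ≤ K`, summing over nonzero eigenvalues bounds the excess by `δ
(1 + log K) |Q_n|` (`norm_trace_kernelPoly_sub_le`). -/

/-- The product of the nonzero eigenvalues of a Hermitian matrix with integer entries has absolute
value at least one. -/
theorem one_le_prod_nonzero_eigenvalues {n : Type*} [Fintype n] [DecidableEq n]
    {A : Matrix n n ℂ} (hA : A.IsHermitian) (hint : ∀ i j, ∃ a : ℤ, A i j = a) :
    1 ≤ ∏ i with hA.eigenvalues i ≠ 0, |hA.eigenvalues i| := by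
  choose M hM using hint
  have hAM : A = (Matrix.of M).map (Int.castRingHom ℂ) := by
    ext i j
    simp [hM]
  set k := (Finset.univ.filter fun i => ¬ hA.eigenvalues i ≠ 0).card with hk
  have h1 : A.charpoly = (∏ i with hA.eigenvalues i ≠ 0,
      (Polynomial.X - Polynomial.C (hA.eigenvalues i : ℂ))) * Polynomial.X ^ k := by
    rw [hA.charpoly_eq, ← Finset.prod_filter_mul_prod_filter_not Finset.univ
      (fun i => hA.eigenvalues i ≠ 0)]
    congr 1
    rw [hk]
    refine Finset.prod_eq_pow_card fun i hi => ?_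
    have : hA.eigenvalues i = 0 := by simpa using hi
    simp [this]
  -- `k` is the multiplicity of the eigenvalue zero, so this is the lowest nonvanishing coefficient;
  -- by `h3` below it is also an integer.
  have h2 : A.charpoly.coeff k = ∏ i with hA.eigenvalues i ≠ 0, (-(hA.eigenvalues i : ℂ)) := by
    have := Polynomial.coeff_mul_X_pow (∏ i with hA.eigenvalues i ≠ 0,
      (Polynomial.X - Polynomial.C (hA.eigenvalues i : ℂ))) k 0
    rw [zero_add, ← h1, Polynomial.coeff_zero_eq_eval_zero, Polynomial.eval_prod] at this
    simpa using this
  have h3 : A.charpoly.coeff k = (((Matrix.of M).charpoly.coeff k : ℤ) : ℂ) := by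
    rw [hAM, Matrix.charpoly_map, Polynomial.coeff_map]
    rfl
  have h4 : ‖A.charpoly.coeff k‖ = ∏ i with hA.eigenvalues i ≠ 0, |hA.eigenvalues i| := by
    rw [h2, norm_prod]
    simp
  rw [← h4, h3, Complex.norm_intCast]
  have h5 : (Matrix.of M).charpoly.coeff k ≠ 0 := by
    intro h0
    rw [h0] at h3
    rw [h2, Int.cast_zero, Finset.prod_eq_zero_iff] at h3
    obtain ⟨i, hi, hi0⟩ := h3
    exact (Finset.mem_filter.1 hi).2 (by simpa using hi0)
  exact_mod_cast Int.one_le_abs h5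

/-- The form in which integrality is used: it prevents too many nonzero eigenvalues from being close
to zero. -/
theorem sum_log_abs_eigenvalues_nonneg {n : Type*} [Fintype n] [DecidableEq n]
    {A : Matrix n n ℂ} (hA : A.IsHermitian) (hint : ∀ i j, ∃ a : ℤ, A i j = a) :
    0 ≤ ∑ i with hA.eigenvalues i ≠ 0, Real.log |hA.eigenvalues i| := by
  rw [← Real.log_prod fun i hi => abs_ne_zero.2 (Finset.mem_filter.1 hi).2]
  exact Real.log_nonneg (one_le_prod_nonzero_eigenvalues hA hint)

theorem trace_aeval_eq_sum {n : Type*} [Fintype n] [DecidableEq n]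
    {A : Matrix n n ℂ} (hA : A.IsHermitian) (P : Polynomial ℂ) :
    (Polynomial.aeval A P).trace = ∑ i, P.eval (hA.eigenvalues i : ℂ) := by
  conv_lhs => rw [hA.spectral_theorem, Polynomial.aeval_algHom_apply,
    Unitary.conjStarAlgAut_apply, Matrix.trace_mul_cycle,
    Unitary.coe_star_mul_self, one_mul]
  have : Matrix.diagonal (RCLike.ofReal ∘ hA.eigenvalues : n → ℂ) =
      Matrix.diagonalAlgHom ℂ (RCLike.ofReal ∘ hA.eigenvalues : n → ℂ) := rfl
  rw [this, Polynomial.aeval_algHom_apply]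
  simp [Matrix.trace, Polynomial.aeval_fn_apply]

theorem finrank_ker_eq_card {n : Type*} [Fintype n] [DecidableEq n]
    {A : Matrix n n ℂ} (hA : A.IsHermitian) :
    Module.finrank ℂ (LinearMap.ker A.mulVecLin) =
      (Finset.univ.filter fun i => ¬ hA.eigenvalues i ≠ 0).card := by
  have h1 := LinearMap.finrank_range_add_finrank_ker A.mulVecLin
  have h2 := hA.rank_eq_card_non_zero_eigs
  rw [Matrix.rank, Fintype.card_subtype] at h2
  rw [h2, Module.finrank_fintype_fun_eq_card, ← Finset.card_univ,
    ← Finset.card_filter_add_card_filter_not (s := Finset.univ)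
      (fun i => hA.eigenvalues i ≠ 0)] at h1
  omega

section
attribute [local instance] Matrix.linftyOpNormedRing Matrix.linftyOpNormedAlgebra

/-- The maximal row sum is a submultiplicative norm on matrices, and such a norm dominates the
spectrum. -/
theorem abs_eigenvalue_le {n : Type*} [Fintype n] [DecidableEq n]
    {A : Matrix n n ℂ} (hA : A.IsHermitian) {K : ℝ} (hK : ∀ i, ∑ j, ‖A i j‖ ≤ K) (i : n) :
    |hA.eigenvalues i| ≤ K := by
  have : Nonempty n := ⟨i⟩
  have h := spectrum.norm_le_norm_of_mem (hA.eigenvalues_mem_spectrum_real i)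
  refine h.trans ?_
  have hK0 : 0 ≤ K := le_trans (Finset.sum_nonneg fun _ _ => norm_nonneg _) (hK i)
  lift K to NNReal using hK0
  rw [Matrix.linfty_opNorm_def]
  refine NNReal.coe_le_coe.2 (Finset.sup_le fun i _ => ?_)
  rw [← NNReal.coe_le_coe]
  simpa using hK i

end

/-! ### The averages `N⁻¹ ∑_{k < N} (1 - c x²)^k` -/

/-- The polynomial `N⁻¹ ∑_{k < N} (1 - c X²)^k`, which approximates the indicator function
of `{0}`. -/
noncomputable def kernelPoly (c : ℝ) (N : ℕ) : Polynomial ℂ :=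
  Polynomial.C ((N : ℂ)⁻¹) *
    ∑ k ∈ Finset.range N, (1 - Polynomial.C (c : ℂ) * Polynomial.X ^ 2) ^ k

/-- The values of `kernelPoly` on the real line. -/
noncomputable def kernelFun (c : ℝ) (N : ℕ) (x : ℝ) : ℝ :=
  (N : ℝ)⁻¹ * ∑ k ∈ Finset.range N, (1 - c * x ^ 2) ^ k

theorem eval_kernelPoly (c : ℝ) (N : ℕ) (x : ℝ) :
    (kernelPoly c N).eval (x : ℂ) = (kernelFun c N x : ℂ) := by
  simp [kernelPoly, kernelFun, Polynomial.eval_finsetSum]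

theorem kernelFun_zero (c : ℝ) {N : ℕ} (hN : N ≠ 0) : kernelFun c N 0 = 1 := by
  have : (N : ℝ) ≠ 0 := by exact_mod_cast hN
  simp [kernelFun, this]

theorem kernelFun_nonneg {c : ℝ} (N : ℕ) {x : ℝ} (h1 : c * x ^ 2 ≤ 1) :
    0 ≤ kernelFun c N x := by
  have : 0 ≤ 1 - c * x ^ 2 := by linarith
  unfold kernelFun
  positivity

theorem kernelFun_le_one {c : ℝ} (hc : 0 ≤ c) {N : ℕ} (hN : N ≠ 0) {x : ℝ}
    (h1 : c * x ^ 2 ≤ 1) : kernelFun c N x ≤ 1 := by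
  have hN' : (0 : ℝ) < N := by exact_mod_cast Nat.pos_of_ne_zero hN
  have h0 : 0 ≤ c * x ^ 2 := by positivity
  unfold kernelFun
  rw [inv_mul_le_iff₀ hN', mul_one]
  refine (Finset.sum_le_card_nsmul _ _ 1 fun k _ => pow_le_one₀ ?_ ?_).trans (by simp)
  · linarith
  · linarith

/-- With `q = 1 - c x²`, the geometric sum satisfies `(1 - q) ∑ q^k = 1 - q^N ≤ 1`. -/
theorem kernelFun_le_inv {c : ℝ} {N : ℕ} (hN : N ≠ 0) {x : ℝ}
    (h0 : 0 < c * x ^ 2) (h1 : c * x ^ 2 ≤ 1) : kernelFun c N x ≤ (N * (c * x ^ 2))⁻¹ := by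
  have hN' : (0 : ℝ) < N := by exact_mod_cast Nat.pos_of_ne_zero hN
  have h := geom_sum_mul_neg (1 - c * x ^ 2) N
  rw [sub_sub_cancel] at h
  have h2 : (0 : ℝ) ≤ (1 - c * x ^ 2) ^ N := pow_nonneg (by linarith) N
  unfold kernelFun
  rw [mul_inv]
  gcongr
  rw [← one_div, le_div_iff₀ h0, h]
  linarith

/-- For large `N`, `kernelFun` is uniformly small with respect to `1 + log K - log |x|`. -/
theorem exists_kernelFun_le {c K δ : ℝ} (hc : 0 < c) (hcK : c * K ^ 2 ≤ 1)
    (hδ : 0 < δ) :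
    ∃ N₀ : ℕ, ∀ N, N₀ ≤ N → N ≠ 0 → ∀ x : ℝ, x ≠ 0 → |x| ≤ K →
      kernelFun c N x ≤ δ * (1 + Real.log K - Real.log |x|) := by
  -- The threshold below which `log K - log |x|` is at least `δ⁻¹`, so that the trivial bound `1`
  -- suffices there. Above it, `N₀` is chosen to push the bound `(N c x²)⁻¹` below `δ`.
  set ε : ℝ := Real.exp (Real.log K - δ⁻¹) with hε
  have hε0 : 0 < ε := Real.exp_pos _
  obtain ⟨N₀, hN₀⟩ := exists_nat_ge ((δ * (c * ε ^ 2))⁻¹)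
  refine ⟨N₀, fun N hN hN0 x hx hxK => ?_⟩
  have hx' : 0 < |x| := abs_pos.2 hx
  have hlog : Real.log |x| ≤ Real.log K := Real.log_le_log hx' hxK
  have hcx : c * x ^ 2 ≤ 1 := by
    refine le_trans ?_ hcK
    rw [← sq_abs x]
    gcongr
  rcases le_or_gt ε |x| with h | h
  · have hx2 : ε ^ 2 ≤ x ^ 2 := by
      rw [← sq_abs x]
      gcongr
    have hN' : (δ * (c * ε ^ 2))⁻¹ ≤ (N : ℝ) := hN₀.trans (by exact_mod_cast hN)
    calc kernelFun c N x ≤ (N * (c * x ^ 2))⁻¹ := kernelFun_le_inv hN0 (by positivity) hcx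
      _ ≤ ((δ * (c * ε ^ 2))⁻¹ * (c * ε ^ 2))⁻¹ := by gcongr
      _ = δ := by field_simp
      _ ≤ _ := by nlinarith
  · have h1 : Real.log |x| ≤ Real.log K - δ⁻¹ := by
      rw [← Real.log_exp (Real.log K - δ⁻¹)]
      exact Real.log_le_log hx' h.le
    calc kernelFun c N x ≤ 1 := kernelFun_le_one hc.le hN0 hcx
      _ = δ * δ⁻¹ := by field_simp
      _ ≤ _ := by
        gcongr
        linarith

/-- The normalized trace of `kernelPoly` approximates the dimension of the kernel, uniformly over
all Hermitian matrices with integer entries and bounded row sums. -/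
theorem norm_trace_kernelPoly_sub_le {c K δ : ℝ} {N : ℕ}
    (hcK : c * K ^ 2 ≤ 1) (hc : 0 < c) (hN0 : N ≠ 0) (hK1 : 1 ≤ K) (hδ : 0 < δ)
    (hN : ∀ x : ℝ, x ≠ 0 → |x| ≤ K → kernelFun c N x ≤ δ * (1 + Real.log K - Real.log |x|))
    {n : Type*} [Fintype n] [DecidableEq n] {A : Matrix n n ℂ} (hA : A.IsHermitian)
    (hint : ∀ i j, ∃ a : ℤ, A i j = a) (hrow : ∀ i, ∑ j, ‖A i j‖ ≤ K) :
    ‖(Polynomial.aeval A (kernelPoly c N)).trace -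
      (Module.finrank ℂ (LinearMap.ker A.mulVecLin) : ℂ)‖ ≤
      δ * (1 + Real.log K) * Fintype.card n := by
  have hle := abs_eigenvalue_le hA hrow
  -- Each zero eigenvalue contributes exactly `1` to the trace, and their number is the kernel
  -- dimension; only the nonzero eigenvalues remain.
  have h1 : (Polynomial.aeval A (kernelPoly c N)).trace -
      (Module.finrank ℂ (LinearMap.ker A.mulVecLin) : ℂ) =
      ((∑ i with hA.eigenvalues i ≠ 0, kernelFun c N (hA.eigenvalues i) : ℝ) : ℂ) := by
    rw [trace_aeval_eq_sum hA, finrank_ker_eq_card hA, sub_eq_iff_eq_add,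
      ← Finset.sum_filter_add_sum_filter_not Finset.univ (fun i => hA.eigenvalues i ≠ 0)]
    simp only [eval_kernelPoly, Complex.ofReal_sum]
    congr 1
    rw [Finset.cast_card]
    refine Finset.sum_congr rfl fun i hi => ?_
    have : hA.eigenvalues i = 0 := by simpa using hi
    rw [this, kernelFun_zero c hN0, Complex.ofReal_one]
  have hnn : ∀ i, 0 ≤ kernelFun c N (hA.eigenvalues i) := fun i => by
    refine kernelFun_nonneg N (le_trans ?_ hcK)
    rw [← sq_abs (hA.eigenvalues i)]
    gcongr
    exact hle i
  rw [h1, Complex.norm_real, Real.norm_of_nonneg (Finset.sum_nonneg fun i _ => hnn i)]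
  have hL : 0 ≤ Real.log K := Real.log_nonneg hK1
  calc ∑ i with hA.eigenvalues i ≠ 0, kernelFun c N (hA.eigenvalues i)
      ≤ ∑ i with hA.eigenvalues i ≠ 0,
          (δ * (1 + Real.log K) - δ * Real.log |hA.eigenvalues i|) := by
        refine Finset.sum_le_sum fun i hi => (hN _ (Finset.mem_filter.1 hi).2 (hle i)).trans ?_
        rw [mul_sub]
    _ = (Finset.univ.filter fun i => hA.eigenvalues i ≠ 0).card * (δ * (1 + Real.log K)) -
          δ * ∑ i with hA.eigenvalues i ≠ 0, Real.log |hA.eigenvalues i| := by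
        rw [Finset.sum_sub_distrib, Finset.sum_const, nsmul_eq_mul, Finset.mul_sum]
    -- The logarithms are discarded here, by integrality.
    _ ≤ (Finset.univ.filter fun i => hA.eigenvalues i ≠ 0).card * (δ * (1 + Real.log K)) :=
        sub_le_self _ (mul_nonneg hδ.le (sum_log_abs_eigenvalues_nonneg hA hint))
    _ ≤ Fintype.card n * (δ * (1 + Real.log K)) := by
        gcongr
        exact Finset.card_filter_le _ _
    _ = _ := by ring

/-! ### Interior points of finite sets -/

section

variable {V : Type u}

/-- A geodesic from `x` to `y` must leave `Q`; the last vertex before its first exit is a boundary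
vertex. -/
theorem exists_mem_boundary {G : SimpleGraph V} (hG : G.Connected) {Q : Finset V} {y : V}
    (hy : y ∉ Q) (k : ℕ) :
    ∀ x ∈ Q, G.dist x y ≤ k → ∃ p ∈ boundary G Q, G.dist x p ≤ k := by
  induction k with
  | zero =>
    intro x hx h
    rw [Nat.le_zero, hG.dist_eq_zero_iff] at h
    exact absurd (h ▸ hx) hy
  | succ k ih =>
    intro x hx h
    obtain ⟨w, hadj, hw⟩ := exists_step hG k h fun h' => hy (h' ▸ hx)
    by_cases hwQ : w ∈ Q
    · obtain ⟨p, hp, hwp⟩ := ih w hwQ hw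
      refine ⟨p, hp, ?_⟩
      have h1 : G.dist x w = 1 := SimpleGraph.dist_eq_one_iff_adj.2 hadj
      have h2 : G.dist x p ≤ G.dist x w + G.dist w p := hG.dist_triangle
      omega
    · classical
      exact ⟨x, Finset.mem_filter.2 ⟨hx, w, hwQ, hadj⟩, by simp⟩

open scoped Classical in
/-- The vertices of `Q` at distance at most `R` from the complement of `Q`. -/
noncomputable def collar (G : SimpleGraph V) (Q : Finset V) (R : ℕ) : Finset V :=
  Q.filter fun x => ∃ y, y ∉ Q ∧ G.dist x y ≤ R

theorem mem_of_notMem_collar {G : SimpleGraph V} {Q : Finset V} {R : ℕ} {x : V} (hx : x ∈ Q)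
    (hxR : x ∉ collar G Q R) {y : V} (hy : G.dist x y ≤ R) : y ∈ Q := by
  classical
  by_contra h
  exact hxR (Finset.mem_filter.2 ⟨hx, y, h, hy⟩)

variable (G : SimpleGraph V) [hG : AQGraph G]

/-- The collar is covered by the `R`-balls around boundary vertices, whose cardinalities are
uniformly bounded. -/
theorem exists_card_collar_le (R : ℕ) :
    ∃ N : ℕ, ∀ Q : Finset V, (collar G Q R).card ≤ (boundary G Q).card * N := by
  classical
  obtain ⟨d, hd⟩ := hG.bounded_degree
  obtain ⟨N, hN⟩ := ball_card_le hG.connected hd R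
  choose T hT hTc using hN
  refine ⟨N, fun Q => ?_⟩
  refine (Finset.card_le_card ?_).trans
    (Finset.card_biUnion_le_card_mul (boundary G Q) T N fun p _ => hTc p)
  intro x hx
  obtain ⟨hxQ, y, hy, hxy⟩ := Finset.mem_filter.1 hx
  obtain ⟨p, hp, hxp⟩ := exists_mem_boundary hG.connected hy R x hxQ hxy
  refine Finset.mem_biUnion.2 ⟨p, hp, ?_⟩
  rw [← Finset.mem_coe, hT]
  change G.dist p x ≤ R
  rwa [SimpleGraph.dist_comm]

variable {G}

theorem tendsto_card_collar {Q : ℕ → Finset V} (hQ : IsFolner G Q) (R : ℕ) :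
    Tendsto (fun n => ((collar G (Q n) R).card : ℝ) / ((Q n).card : ℝ)) atTop (𝓝 0) := by
  obtain ⟨N, hN⟩ := exists_card_collar_le G R
  refine squeeze_zero (fun n => by positivity) (fun n => ?_)
    (by simpa using hQ.tendsto.mul_const (N : ℝ))
  rw [div_mul_eq_mul_div]
  gcongr
  exact_mod_cast hN (Q n)

/-! ### Polynomials in truncations -/

open scoped Classical in
/-- Away from the boundary, a polynomial in a truncation of `B` has the entries of the same
polynomial in `B`. -/
theorem exists_aeval_truncation_eq (B : PatternAlgebra G) (P : Polynomial ℂ) :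
    ∃ R : ℕ, ∀ (Q : Finset V) (x y : Q), (x : V) ∉ collar G Q R →
      Polynomial.aeval (truncation B Q) P x y = (Polynomial.aeval B P) (x : V) (y : V) := by
  have hanti : ∀ {Q : Finset V} {R S : ℕ} {x : V}, R ≤ S → x ∉ collar G Q S →
      x ∉ collar G Q R := fun {Q R S x} h hx hx' => by
    obtain ⟨h1, y, hy, h2⟩ := Finset.mem_filter.1 hx'
    exact hx (Finset.mem_filter.2 ⟨h1, y, hy, h2.trans h⟩)
  induction P using Polynomial.induction_on with
  | C a =>
    -- For constants no collar is needed: both sides are multiples of the identity.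
    refine ⟨0, fun Q x y _ => ?_⟩
    rw [Polynomial.aeval_C, Polynomial.aeval_C, Algebra.algebraMap_eq_smul_one,
      Algebra.algebraMap_eq_smul_one, PatternAlgebra.smul_apply, PatternAlgebra.one_apply]
    by_cases h : x = y
    · subst h
      simp
    · have h' : (x : V) ≠ y := fun h' => h (Subtype.ext h')
      simp [Matrix.one_apply_ne h, h']
  | add p q hp hq =>
    obtain ⟨R, hR⟩ := hp
    obtain ⟨S, hS⟩ := hq
    refine ⟨max R S, fun Q x y hx => ?_⟩
    rw [map_add, map_add, Matrix.add_apply, PatternAlgebra.add_apply,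
      hR Q x y (hanti (le_max_left _ _) hx), hS Q x y (hanti (le_max_right _ _) hx)]
  | monomial n a ih =>
    obtain ⟨R, hR⟩ := ih
    obtain ⟨r, hr⟩ := B.exists_invariantAt
    -- Each further factor `B` costs its propagation `r`. Outside the `(r + R)`-collar the row of
    -- `B` at `x` is supported in `Q`, and every `z` within distance `r` of `x` is still outside the
    -- `R`-collar, where the induction hypothesis applies.
    refine ⟨r + R, fun Q x y hx => ?_⟩
    have hX : Polynomial.C a * Polynomial.X ^ (n + 1) =
        Polynomial.X * (Polynomial.C a * Polynomial.X ^ n) := by ring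
    have hsupp : Function.support (B (x : V)) ⊆ Q := fun z hz => by
      refine mem_of_notMem_collar x.2 hx (R := r + R) ?_
      by_contra h
      exact hz (hr.propagation _ _ (by omega))
    have e1 : Polynomial.aeval (truncation B Q) (Polynomial.C a * Polynomial.X ^ (n + 1)) =
        truncation B Q *
          Polynomial.aeval (truncation B Q) (Polynomial.C a * Polynomial.X ^ n) := by
      rw [hX, map_mul, Polynomial.aeval_X]
    have e2 : Polynomial.aeval B (Polynomial.C a * Polynomial.X ^ (n + 1)) =
        B * Polynomial.aeval B (Polynomial.C a * Polynomial.X ^ n) := by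
      rw [hX, map_mul, Polynomial.aeval_X]
    rw [e1, e2, Matrix.mul_apply, PatternAlgebra.mul_apply', PatternAlgebra.mulVec_eq_sum _ _ _ hsupp,
      ← Finset.sum_coe_sort Q]
    refine Finset.sum_congr rfl fun z _ => ?_
    change B x z * _ = _
    by_cases hz : G.dist (x : V) z ≤ r
    · rw [hR Q z y]
      intro hz'
      obtain ⟨-, w, hw, hzw⟩ := Finset.mem_filter.1 hz'
      refine hw (mem_of_notMem_collar x.2 hx ?_)
      have : G.dist (x : V) w ≤ G.dist (x : V) z + G.dist (z : V) w :=
        hG.connected.dist_triangle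
      omega
    · rw [hr.propagation _ _ (not_le.1 hz), zero_mul, zero_mul]

-- Row sums are submultiplicative, and truncating `B` does not increase them. The uniformity in `Q`
-- controls the diagonal entries at collar vertices, where truncation and polynomial need not
-- commute.
open scoped Classical in
theorem exists_rowSum_aeval_truncation_le (B : PatternAlgebra G) (P : Polynomial ℂ) :
    ∃ D : ℝ, 0 ≤ D ∧ ∀ (Q : Finset V) (x : Q),
      ∑ y, ‖Polynomial.aeval (truncation B Q) P x y‖ ≤ D := by
  induction P using Polynomial.induction_on with
  | C a =>
    refine ⟨‖a‖, norm_nonneg _, fun Q x => ?_⟩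
    rw [Polynomial.aeval_C]
    simp [Matrix.algebraMap_matrix_apply, apply_ite]
  | add p q hp hq =>
    obtain ⟨R, hR0, hR⟩ := hp
    obtain ⟨S, hS0, hS⟩ := hq
    refine ⟨R + S, add_nonneg hR0 hS0, fun Q x => ?_⟩
    rw [map_add]
    refine (Finset.sum_le_sum fun y _ => norm_add_le _ _).trans ?_
    rw [Finset.sum_add_distrib]
    exact add_le_add (hR Q x) (hS Q x)
  | monomial n a ih =>
    obtain ⟨D, hD0, hD⟩ := ih
    obtain ⟨C, hC0, hC⟩ := B.exists_rowSum_le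
    refine ⟨C * D, mul_nonneg hC0 hD0, fun Q x => ?_⟩
    have hX : Polynomial.C a * Polynomial.X ^ (n + 1) =
        Polynomial.X * (Polynomial.C a * Polynomial.X ^ n) := by ring
    rw [hX, map_mul, Polynomial.aeval_X]
    set M := Polynomial.aeval (truncation B Q) (Polynomial.C a * Polynomial.X ^ n)
    calc ∑ y, ‖(truncation B Q * M) x y‖ ≤ ∑ y, ∑ z : Q, ‖B x z‖ * ‖M z y‖ := by
          refine Finset.sum_le_sum fun y _ => ?_
          rw [Matrix.mul_apply]
          exact (norm_sum_le _ _).trans_eq (Finset.sum_congr rfl fun z _ => norm_mul _ _)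
      _ = ∑ z : Q, ‖B x z‖ * ∑ y, ‖M z y‖ := by
          rw [Finset.sum_comm]
          simp only [Finset.mul_sum]
      _ ≤ ∑ z : Q, ‖B x z‖ * D := by
          gcongr with z
          exact hD Q z
      _ = (∑ z ∈ Q, ‖B x z‖) * D := by
          rw [← Finset.sum_mul, Finset.sum_coe_sort Q fun z => ‖B x z‖]
      _ ≤ C * D := by
          gcongr
          exact hC x Q

open scoped Classical in
/-- The normalized traces of a polynomial in the truncations of `B` converge to the trace of the
same polynomial in `B`. -/
theorem tendsto_trace_aeval_truncation (B : PatternAlgebra G) (P : Polynomial ℂ)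
    {Q : ℕ → Finset V} (hQ : IsFolner G Q) :
    Tendsto (fun n => (Polynomial.aeval (truncation B (Q n)) P).trace / ((Q n).card : ℂ)) atTop
      (𝓝 (PatternAlgebra.trace G (Polynomial.aeval B P))) := by
  obtain ⟨R, hR⟩ := exists_aeval_truncation_eq B P
  obtain ⟨D, hD0, hD⟩ := exists_rowSum_aeval_truncation_le B P
  obtain ⟨C, hC0, hC⟩ := (Polynomial.aeval B P).exists_rowSum_le
  -- Diagonal entries cancel off the collar; at a collar vertex they differ by at most `D + C`.
  have key : ∀ n, ‖(Polynomial.aeval (truncation B (Q n)) P).trace / ((Q n).card : ℂ) -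
      (∑ x ∈ Q n, (Polynomial.aeval B P) x x) / ((Q n).card : ℂ)‖ ≤
      (D + C) * (((collar G (Q n) R).card : ℝ) / ((Q n).card : ℝ)) := fun n => by
    rw [← sub_div, norm_div, Complex.norm_natCast, ← mul_div_assoc]
    gcongr
    rw [Matrix.trace, ← Finset.sum_coe_sort (Q n), ← Finset.sum_sub_distrib]
    calc ‖∑ x : Q n, ((Polynomial.aeval (truncation B (Q n)) P).diag x -
            (Polynomial.aeval B P) (x : V) (x : V))‖
        ≤ ∑ x : Q n, if (x : V) ∈ collar G (Q n) R then D + C else 0 := by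
          refine norm_sum_le_of_le _ fun x _ => ?_
          rw [Matrix.diag_apply]
          split_ifs with hx
          · refine (norm_sub_le _ _).trans (add_le_add ?_ ?_)
            · exact (Finset.single_le_sum (f := fun y =>
                ‖Polynomial.aeval (truncation B (Q n)) P x y‖) (fun _ _ => norm_nonneg _)
                (Finset.mem_univ x)).trans (hD (Q n) x)
            · simpa using hC x {(x : V)}
          · rw [hR (Q n) x x hx, sub_self, norm_zero]
      _ = ∑ x ∈ Q n, if x ∈ collar G (Q n) R then D + C else 0 :=
          Finset.sum_coe_sort (Q n) fun x => if x ∈ collar G (Q n) R then D + C else 0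
      _ = ((Q n).filter fun x => x ∈ collar G (Q n) R).card * (D + C) := by
          rw [← Finset.sum_filter, Finset.sum_const, nsmul_eq_mul]
      _ ≤ (D + C) * (collar G (Q n) R).card := by
          rw [mul_comm]
          gcongr
          exact fun x hx => (Finset.mem_filter.1 hx).2
  have h0 := squeeze_zero_norm key (by simpa using (tendsto_card_collar hQ R).const_mul (D + C))
  simpa using h0.add (PatternAlgebra.tendsto_trace (Polynomial.aeval B P) hQ)

/-! ### The trace of the kernel projection -/

-- From `0 ≤ c T² ≤ 1` follows `0 ≤ 1 - c T² ≤ 1`. This is the contraction hypothesis of the mean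
-- ergodic theorem.
open scoped ComplexOrder in
theorem norm_one_sub_smul_sq_le {H : Type*} [NormedAddCommGroup H] [InnerProductSpace ℂ H]
    [CompleteSpace H] {T : H →L[ℂ] H} (hT : IsSelfAdjoint T) {c : ℝ} (hc0 : 0 ≤ c)
    (hc1 : c * ‖T‖ ^ 2 ≤ 1) : ‖1 - (c : ℂ) • T ^ 2‖ ≤ 1 := by
  have hsq : 0 ≤ T ^ 2 := by
    have := star_mul_self_nonneg T
    rwa [hT.star_eq, ← sq] at this
  have h0 : 0 ≤ (c : ℂ) • T ^ 2 := smul_nonneg (by exact_mod_cast hc0) hsq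
  have h1 : ‖(c : ℂ) • T ^ 2‖ ≤ 1 := by
    rw [norm_smul, Complex.norm_real, Real.norm_of_nonneg hc0]
    exact (mul_le_mul_of_nonneg_left (norm_pow_le' T two_pos) hc0).trans hc1
  have h2 : (c : ℂ) • T ^ 2 ≤ 1 := (CStarAlgebra.norm_le_one_iff_of_nonneg _ h0).1 h1
  exact (CStarAlgebra.norm_le_one_iff_of_nonneg _ (sub_nonneg.2 h2)).2 (sub_le_self _ h0)

/-- By von Neumann's mean ergodic theorem, the Cesàro means of the powers of the contraction `1 - c
T²` converge strongly to the projection onto its fixed vectors. These form `ker T²`, which equals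
`ker T` because `T` is self-adjoint. The trace is the matrix coefficient at the vector `1`, so
strong convergence suffices. -/
theorem tendsto_trace_kernelPoly {B : PatternAlgebra G} (hB : star B = B) {c : ℝ} (hc : 0 < c)
    (hcB : c * ‖gnsRep G B‖ ^ 2 ≤ 1) :
    Tendsto (fun N => PatternAlgebra.trace G (Polynomial.aeval B (kernelPoly c N))) atTop
      (𝓝 (vnTrace G (kernelProjection G B))) := by
  set T := gnsRep G B with hTdef
  have hT : IsSelfAdjoint T := by rw [IsSelfAdjoint, hTdef, ← map_star, hB]
  set f : GNSSpace G →L[ℂ] GNSSpace G := 1 - (c : ℂ) • T ^ 2 with hf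
  have hker : f.eqLocus (1 : GNSSpace G →L[ℂ] GNSSpace G) = T.ker := by
    rw [← ContinuousLinearMap.ker_adjoint_comp_self T, ← ContinuousLinearMap.star_eq_adjoint,
      hT.star_eq]
    ext x
    rw [LinearMap.mem_eqLocus, hf]
    simp [hc.ne', sq]
  have herg := f.tendsto_birkhoffAverage_orthogonalProjection
    (norm_one_sub_smul_sq_le hT hc.le hcB) ((1 : PatternAlgebra G) : GNSSpace G)
  have hproj : ((f.eqLocus (1 : GNSSpace G →L[ℂ] GNSSpace G)).orthogonalProjectionOnto
      ((1 : PatternAlgebra G) : GNSSpace G) : GNSSpace G) =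
      T.ker.starProjection ((1 : PatternAlgebra G) : GNSSpace G) := by
    simp only [← hker]; rfl
  rw [hproj] at herg
  refine ((tendsto_const_nhds (x := ((1 : PatternAlgebra G) : GNSSpace G))).inner herg).congr
    fun N => ?_
  rw [← vnTrace_gnsRep]
  unfold vnTrace
  congr 1
  have : gnsRep G (Polynomial.aeval B (kernelPoly c N)) =
      (N : ℂ)⁻¹ • ∑ k ∈ Finset.range N, f ^ k := by
    simp only [kernelPoly, hf, hTdef, ← Polynomial.smul_eq_C_mul, map_smul, map_sum, map_pow,
      map_sub, map_one, Polynomial.aeval_X]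
  change _ = gnsRep G (Polynomial.aeval B (kernelPoly c N)) _
  rw [this]
  simp [birkhoffAverage, birkhoffSum]

end

/-! ### Reduction to integer entries and exchange of the limits -/

section

variable {V : Type u} {G : SimpleGraph V} [hG : AQGraph G]

/-- Symmetry of the operator is tested on pairs of point masses, whose matrix coefficients are the
entries. -/
theorem star_eq_of_isPositive {B : PatternAlgebra G} (hpos : B.l2Operator.IsPositive) :
    star B = B := by
  classical
  have happ : ∀ x y : V, B.l2Operator (lp.single 2 y (1 : ℂ)) x = B x y := fun x y => by
    rw [PatternAlgebra.l2Operator_apply, finsum_eq_single _ y]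
    · simp
    · intro z hz
      simp [Pi.single_eq_of_ne hz]
  ext x y
  have h := hpos.isSymmetric (lp.single 2 y (1 : ℂ)) (lp.single 2 x (1 : ℂ))
  simp only [ContinuousLinearMap.coe_coe] at h
  rw [lp.inner_single_left, lp.inner_single_right, happ, happ] at h
  rw [PatternAlgebra.star_apply]
  simpa using (congrArg star h).symm

theorem isHermitian_truncation {B : PatternAlgebra G} (hB : star B = B) (Q : Finset V) :
    (truncation B Q).IsHermitian := by
  ext x y
  change star (B y x) = B x y
  rw [← PatternAlgebra.star_apply, hB]

/-- A pattern-invariant matrix has only finitely many different entries. -/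
theorem finite_range_entries (B : PatternAlgebra G) :
    (Set.range fun p : V × V => B p.1 p.2).Finite := by
  obtain ⟨r, hr⟩ := B.exists_invariantAt
  have h1 : (⋃ α : Pattern G r, (fun y => B (Quotient.out α) y) ''
      rBall G (Quotient.out α) r).Finite :=
    Set.finite_iUnion fun α => (rBall_finite G _ r).image _
  refine (h1.insert 0).subset ?_
  rintro _ ⟨⟨x, y⟩, rfl⟩
  by_cases h : G.dist x y ≤ r
  · right
    obtain ⟨φ, hφ⟩ : SamePattern G r x (Quotient.out (patternOf G r x)) :=
      Quotient.exact (Quotient.out_eq (patternOf G r x)).symm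
    refine Set.mem_iUnion.2 ⟨patternOf G r x, φ ⟨y, h⟩, (φ ⟨y, h⟩).2, ?_⟩
    exact (hr.invariant _ _ φ hφ ⟨y, h⟩).symm
  · left
    exact hr.propagation x y (not_le.1 h)

theorem exists_common_denominator {B : PatternAlgebra G}
    (hrat : ∀ x y : V, ∃ q : ℚ, B x y = (q : ℂ)) :
    ∃ m : ℕ, m ≠ 0 ∧ ∀ x y : V, ∃ a : ℤ, ((m : ℂ) • B) x y = a := by
  choose q hq using hrat
  have hfin : (Set.range fun p : V × V => q p.1 p.2).Finite := by
    refine Set.Finite.of_finite_image (f := fun a : ℚ => (a : ℂ)) ?_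
      (Rat.cast_injective.injOn)
    refine (finite_range_entries B).subset ?_
    rintro _ ⟨_, ⟨p, rfl⟩, rfl⟩
    exact ⟨p, hq _ _⟩
  refine ⟨∏ a ∈ hfin.toFinset, a.den, Finset.prod_ne_zero_iff.2 fun a _ => a.den_nz,
    fun x y => ?_⟩
  have hmem : q x y ∈ hfin.toFinset := hfin.mem_toFinset.2 ⟨(x, y), rfl⟩
  obtain ⟨k, hk⟩ := Finset.dvd_prod_of_mem (fun a : ℚ => a.den) hmem
  refine ⟨k * (q x y).num, ?_⟩
  rw [PatternAlgebra.smul_apply, hq, hk]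
  have := Rat.mul_den_eq_num (q x y)
  rw [← Rat.cast_inj (α := ℂ)] at this
  push_cast at this ⊢
  rw [← this]
  ring

/-- Approximation of the ground state density for self-adjoint matrices with integer entries. -/
theorem tendsto_finrank_ker_truncation {B : PatternAlgebra G} (hB : star B = B)
    (hint : ∀ x y : V, ∃ a : ℤ, B x y = a) {Q : ℕ → Finset V} (hQ : IsFolner G Q) :
    Tendsto
      (fun n => (Module.finrank ℂ (LinearMap.ker (truncation B (Q n)).mulVecLin) : ℂ) /
        ((Q n).card : ℂ))
      atTop (𝓝 (vnTrace G (kernelProjection G B))) := by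
  classical
  obtain ⟨K₀, hK₀, hrow⟩ := B.exists_rowSum_le
  set K : ℝ := K₀ + 1
  have hK1 : 1 ≤ K := by simpa [K] using hK₀
  -- Small enough for both uses: `c x² ≤ 1` on the eigenvalues of all truncations, and `1 - c
  -- ψ_G(B)²` a contraction on the GNS space.
  set c : ℝ := (K ^ 2 + ‖gnsRep G B‖ ^ 2)⁻¹ with hc
  have hc0 : 0 < c := by positivity
  have hcK : c * K ^ 2 ≤ 1 := by
    rw [hc, inv_mul_le_iff₀ (by positivity)]
    nlinarith [sq_nonneg ‖gnsRep G B‖]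
  have hcB : c * ‖gnsRep G B‖ ^ 2 ≤ 1 := by
    rw [hc, inv_mul_le_iff₀ (by positivity)]
    nlinarith [sq_nonneg K]
  have hL : 0 < 1 + Real.log K := by
    have := Real.log_nonneg hK1
    linarith
  rw [Metric.tendsto_atTop]
  intro ε hε
  set δ : ℝ := ε / 3 / (1 + Real.log K) with hδ
  have hδ0 : 0 < δ := by positivity
  obtain ⟨N₀, hN₀⟩ := exists_kernelFun_le hc0 hcK hδ0
  -- `N` is fixed before `n`: the spectral estimate `h1` holds for all `n` at once, so only the
  -- trace convergence for this single polynomial determines `n₀`.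
  obtain ⟨N, hNt, hN1, hN2⟩ := ((Metric.tendsto_nhds.1 (tendsto_trace_kernelPoly hB hc0 hcB)
    (ε / 3) (by positivity)).and ((eventually_ge_atTop N₀).and (eventually_ge_atTop 1))).exists
  have hN : N ≠ 0 := by omega
  obtain ⟨n₀, hn₀⟩ := Metric.tendsto_atTop.1
    (tendsto_trace_aeval_truncation B (kernelPoly c N) hQ) (ε / 3) (by positivity)
  refine ⟨n₀, fun n hn => ?_⟩
  have hq : (0 : ℝ) < (Q n).card := by exact_mod_cast (hQ.nonempty n).card_pos
  have h1 := norm_trace_kernelPoly_sub_le hcK hc0 hN hK1 hδ0 (hN₀ N hN1 hN)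
    (isHermitian_truncation hB (Q n)) (fun i j => hint i j) (fun i => by
      change ∑ j : Q n, ‖B i j‖ ≤ K
      rw [Finset.sum_coe_sort (Q n) fun j => ‖B i j‖]
      exact (hrow i (Q n)).trans (by simp [K]))
  rw [Fintype.card_coe, hδ, div_mul_cancel₀ _ hL.ne'] at h1
  have h2 : dist ((Module.finrank ℂ (LinearMap.ker (truncation B (Q n)).mulVecLin) : ℂ) /
      ((Q n).card : ℂ)) ((Polynomial.aeval (truncation B (Q n)) (kernelPoly c N)).trace /
      ((Q n).card : ℂ)) ≤ ε / 3 := by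
    rw [dist_comm, dist_eq_norm, ← sub_div, norm_div, Complex.norm_natCast, div_le_iff₀ hq]
    exact h1
  have h3 := hn₀ n hn
  calc _ ≤ _ := dist_triangle4 _ _ _ _
    _ < ε / 3 + ε / 3 + ε / 3 := add_lt_add (add_lt_add_of_le_of_lt h2 h3) hNt
    _ = ε := by ring

theorem ker_mulVecLin_smul {n : Type*} [Fintype n] (A : Matrix n n ℂ) {c : ℂ} (hc : c ≠ 0) :
    LinearMap.ker (c • A).mulVecLin = LinearMap.ker A.mulVecLin := by
  ext v
  simp [hc]

theorem vnTrace_kernelProjection_congr {A B : PatternAlgebra G}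
    (h : (gnsRep G A).ker = (gnsRep G B).ker) :
    vnTrace G (kernelProjection G A) = vnTrace G (kernelProjection G B) := by
  have : kernelProjection G A = kernelProjection G B := by
    refine Subtype.ext ?_
    simp only [kernelProjection, h]
  rw [this]

end

end QuasiCrystal

theorem proposition6p1 {V : Type*} (G : SimpleGraph V) [QuasiCrystal.AQGraph G]
    (B : QuasiCrystal.PatternAlgebra G)
    (hpos : B.l2Operator.IsPositive)
    (hrat : ∀ x y : V, ∃ q : ℚ, B x y = (q : ℂ))
    (Q : ℕ → Finset V) (hQ : QuasiCrystal.IsFolner G Q) :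
    Tendsto
      (fun n => (Module.finrank ℂ
          (LinearMap.ker (QuasiCrystal.truncation B (Q n)).mulVecLin) : ℂ) / ((Q n).card : ℂ))
      atTop
      (𝓝 (QuasiCrystal.vnTrace G (QuasiCrystal.kernelProjection G B))) := by
  -- Passing from `B` to `m B` clears denominators and alters neither the kernels of the truncations
  -- nor that of `ψ_G(B)`.
  obtain ⟨m, hm, hint⟩ := QuasiCrystal.exists_common_denominator hrat
  have hm' : (m : ℂ) ≠ 0 := Nat.cast_ne_zero.2 hm
  have hB := QuasiCrystal.star_eq_of_isPositive hpos
  have hmB : star ((m : ℂ) • B) = (m : ℂ) • B := by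
    rw [star_smul, hB, Complex.star_def, Complex.conj_natCast]
  have h := QuasiCrystal.tendsto_finrank_ker_truncation hmB hint hQ
  have hker : (QuasiCrystal.gnsRep G ((m : ℂ) • B)).ker = (QuasiCrystal.gnsRep G B).ker := by
    ext v
    rw [map_smul]
    simp [hm]
  rw [QuasiCrystal.vnTrace_kernelProjection_congr hker] at h
  refine h.congr fun n => ?_
  have : QuasiCrystal.truncation ((m : ℂ) • B) (Q n) = (m : ℂ) • QuasiCrystal.truncation B (Q n) :=
    rfl
  rw [this, QuasiCrystal.ker_mulVecLin_smul _ hm']
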